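/- Let $X$ be a complex Banach space, $\mathbf T=(T_t)_{t\ge 0}$ a strongly continuous semigroup on $X$ with generator $A$, resolvent set $\rho(A)$, resolvent $R(\lambda)=(\lambda-A)^{-1}$ and growth bound $\omega_0=\inf\{w\in\mathbb R:\exists M\ \forall t\ge 0,\ \|T_t\|\le Me^{wt}\}\in[-\infty,\infty)$. Let $\alpha\ge 0$ and $\omega>\omega_0$. Let $(\omega-A)^{-\alpha}x=\frac1{\Gamma(\alpha)}\int_0^\infty t^{\alpha-1}e^{-\omega t}T_tx\,dt$ if $\alpha>0$, and $(\omega-A)^{0}=I$; let $(\omega-A)^{\alpha}$ be the inverse of the injective operator $(\omega-A)^{-\alpha}$, and let $X_\alpha$ be the domain of $(\omega-A)^\alpha$ with the norm $\|x\|_\alpha=\|(\omega-A)^\alpha x\|$. Let $\mathbb T=\mathbb R/2\pi\mathbb Z$ with the measure $d\theta/2\pi$, and $\hat\varphi(k)=\frac1{2\pi}\int_0^{2\pi}\varphi(\theta)e^{-ik\theta}\,d\theta$. A quasi-normed function lattice $F$ on $\mathbb T$ is a linear space of (classes of) real measurable functions on $\mathbb T$ with a quasi-norm such that $g\in F$ and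 $|f|\le|g|$ a.e. imply $f\in F$ and $\|f\|_F\le\|g\|_F$; $F(\mathbb T,X)$ consists of the $X$-valued functions $g$ with $\|g(\cdot)\|\in F$, and $\|g\|_{F(\mathbb T,X)}$ is the quasi-norm of $\|g(\cdot)\|$ in $F$. The sequence $\{R(ik)\}_{k\in\mathbb Z}$ is called a multiplier from $L_p(\mathbb T,X_\alpha)$ to $E$, where $E=L_p(\mathbb T,X)$ or $E=F(\mathbb T,X)$, if there is a constant $C$ such that for every trigonometric polynomial $f=\sum_k e^{ik\theta}x_k$ (finite sum, $x_k\in X_\alpha$) the function $Lf=\sum_k e^{ik\theta}R(ik)x_k$ belongs to $E$ and $\|Lf\|_E\le C\|f\|_{L_p(\mathbb T,X_\alpha)}$. **Theorem.** Suppose $i\mathbb Z\subset\rho(A)$. Then the following conditions are equivalent: 1. $X_\alpha\subset\operatorname{Rg}(I-T_{2\pi})$. 2. For every $x\in X_\alpha$ the sum $(C,1)\sum_{k\in\mathbb Z}R(ik)x=\lim_{N\to\infty}\frac1N\sum_{n=0}^{N-1}\sum_{|k|\le n}R(ik)x$ exists in the norm of $X$. 3. (a) $\{R(ik)\}_{k\in\mathbb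 Z}$ is a multiplier from $L_p(\mathbb T,X_\alpha)$ to $L_p(\mathbb T,X)$ for some $p$ with $1\le p<\infty$; (b) the same for all $p$ with $1\le p<\infty$. (Each of (a) and (b) is equivalent to the other conditions.) 4. There is a quasi-normed function lattice $F$ on $\mathbb T$ such that $\{R(ik)\}_{k\in\mathbb Z}$ is a multiplier from $L_1(\mathbb T,X_\alpha)$ to $F(\mathbb T,X)$. 5. There is a constant $K>0$ such that for all $x\in X_\alpha$, $x^*\in X^*$ and $\varphi\in C^\infty(\mathbb T)$ the series $\sum_{k\in\mathbb Z}\langle x^*,R(ik)x\rangle\hat\varphi(k)$ converges absolutely and $$\Bigl|\sum_{k\in\mathbb Z}\langle x^*,R(ik)x\rangle\,\hat\varphi(k)\Bigr|\le K\,\|x\|_\alpha\,\|x^*\|\,\|\varphi\|_{L_1(\mathbb T)}.$$ -/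

import Mathlib

open Filter Topology MeasureTheory Set
open scoped Real ENNReal NNReal

noncomputable section

namespace SemigroupMultiplier

/-- A strongly continuous one-parameter semigroup `(T t)_{t ≥ 0}` of bounded operators on `X`.
The values `T t` for `t < 0` carry no information and are never used. -/
structure C0Semigroup (X : Type*) [NormedAddCommGroup X] [NormedSpace ℂ X] where
  T : ℝ → X →L[ℂ] X
  T_zero : T 0 = ContinuousLinearMap.id ℂ X
  T_add : ∀ s t : ℝ, 0 ≤ s → 0 ≤ t → T (s + t) = (T s).comp (T t)
  continuousOn : ∀ x : X, ContinuousOn (fun t : ℝ => T t x) (Ici 0)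

section Operators

variable {X : Type*} [NormedAddCommGroup X] [NormedSpace ℂ X]

/-- `R` is the (bounded, two-sided) inverse of `z - A`. -/
def IsResolventAt (A : X →ₗ.[ℂ] X) (z : ℂ) (R : X →L[ℂ] X) : Prop :=
  (∀ y : X, ∃ h : R y ∈ A.domain, z • R y - A ⟨R y, h⟩ = y) ∧
    ∀ x : A.domain, R (z • (x : X) - A x) = x

/-- The resolvent set `ρ(A)`. -/
def resSet (A : X →ₗ.[ℂ] X) : Set ℂ :=
  {z | ∃ R : X →L[ℂ] X, IsResolventAt A z R}

open Classical in
/-- The resolvent `R(z, A) = (z - A)⁻¹` for `z ∈ ρ(A)` (and `0` elsewhere). -/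
def res (A : X →ₗ.[ℂ] X) (z : ℂ) : X →L[ℂ] X :=
  if h : ∃ R : X →L[ℂ] X, IsResolventAt A z R then h.choose else 0

/-- The Cesàro sum `(C,1) ∑_{k ∈ ℤ} u k` exists in norm: the arithmetic means of the symmetric
partial sums converge. -/
def CesaroSummable (u : ℤ → X) : Prop :=
  ∃ S : X, Tendsto
    (fun N : ℕ => (N : ℂ)⁻¹ • ∑ n ∈ Finset.range N, ∑ k ∈ Finset.Icc (-(n : ℤ)) (n : ℤ), u k)
    atTop (𝓝 S)

end Operators

namespace C0Semigroup

variable {X : Type*} [NormedAddCommGroup X] [NormedSpace ℂ X] (S : C0Semigroup X)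

/-- `A x = y`: the right derivative at `0` of the orbit of `x` is `y`. -/
def GeneratorRel (x y : X) : Prop :=
  Tendsto (fun t : ℝ => (t : ℂ)⁻¹ • (S.T t x - x)) (𝓝[>] 0) (𝓝 y)

theorem GeneratorRel.add {S : C0Semigroup X} {x y x' y' : X} (h : S.GeneratorRel x y)
    (h' : S.GeneratorRel x' y') : S.GeneratorRel (x + x') (y + y') := by
  refine (Tendsto.add h h').congr fun t => ?_
  rw [map_add, ← smul_add]
  congr 1
  abel

theorem GeneratorRel.smul {S : C0Semigroup X} {x y : X} (c : ℂ) (h : S.GeneratorRel x y) :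
    S.GeneratorRel (c • x) (c • y) := by
  refine (Tendsto.const_smul h c).congr fun t => ?_
  rw [map_smul, ← smul_sub, smul_comm]

theorem GeneratorRel.zero (S : C0Semigroup X) : S.GeneratorRel 0 0 := by
  simp [GeneratorRel]

/-- The infinitesimal generator `A` of the semigroup, with its natural domain. -/
def generator : X →ₗ.[ℂ] X where
  domain :=
    { carrier := {x | ∃ y, S.GeneratorRel x y}
      add_mem' := fun ⟨_, h⟩ ⟨_, h'⟩ => ⟨_, h.add h'⟩
      zero_mem' := ⟨0, GeneratorRel.zero S⟩
      smul_mem' := fun c _ ⟨_, h⟩ => ⟨_, h.smul c⟩ }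
  toFun :=
    { toFun := fun x => x.2.choose
      map_add' := fun x y =>
        tendsto_nhds_unique (x + y).2.choose_spec (x.2.choose_spec.add y.2.choose_spec)
      map_smul' := fun c x =>
        tendsto_nhds_unique (c • x).2.choose_spec (x.2.choose_spec.smul c) }

/-- The growth bound `ω₀`: the infimum of all real `w` with `‖T t‖ ≤ M e^{w t}`, `t ≥ 0`, for some
`M` (possibly `-∞`). -/
def growthBound : EReal :=
  sInf {r : EReal | ∃ w : ℝ, r = (w : EReal) ∧
    ∃ M : ℝ, ∀ t : ℝ, 0 ≤ t → ‖S.T t‖ ≤ M * Real.exp (w * t)}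

/-- The integrand `t^(α-1) e^{-ω t} T_t x` of the fractional integral. -/
def fracIntegrand (ω α : ℝ) (x : X) (t : ℝ) : X :=
  ((t ^ (α - 1) * Real.exp (-(ω * t)) : ℝ) : ℂ) • S.T t x

/-- For `α > 0`, the bounded operator
`(ω - A)^{-α} x = Γ(α)⁻¹ ∫_0^∞ t^(α-1) e^{-ω t} T_t x dt`.
It is written as a partially defined operator on the subspace where the integral converges
absolutely, so that no junk value enters; this is the whole space when `ω` exceeds the growth
bound. -/
def fracIntegral (ω α : ℝ) : X →ₗ.[ℂ] X where
  domain :=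
    { carrier := {x | IntegrableOn (S.fracIntegrand ω α x) (Ioi 0)}
      add_mem' := fun {x y} hx hy => by
        refine (Integrable.add hx hy).congr (Eventually.of_forall fun t => ?_)
        simp [fracIntegrand]
      zero_mem' := by
        refine (integrable_zero ℝ X (volume.restrict (Ioi 0))).congr
          (Eventually.of_forall fun t => ?_)
        simp [fracIntegrand]
      smul_mem' := fun c x hx => by
        refine (Integrable.smul c hx).congr (Eventually.of_forall fun t => ?_)
        simp only [fracIntegrand, Pi.smul_apply, map_smul]
        rw [smul_comm] }
  toFun :=
    { toFun := fun x =>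
        ((Real.Gamma α)⁻¹ : ℂ) • ∫ t in Ioi (0 : ℝ), S.fracIntegrand ω α x t
      map_add' := fun x y => by
        rw [← smul_add, ← integral_add x.2 y.2]
        congr 2
        funext t
        simp [fracIntegrand]
      map_smul' := fun c x => by
        simp only [RingHom.id_apply]
        rw [smul_comm c, ← integral_smul c]
        congr 2
        funext t
        simp only [fracIntegrand, Submodule.coe_smul, map_smul]
        rw [smul_comm] }

open Classical in
/-- The negative fractional power `(ω - A)^{-α}`, `α ≥ 0`; it is the identity for `α = 0`. -/
def negFracPow (ω α : ℝ) : X →ₗ.[ℂ] X :=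
  if α = 0 then (LinearMap.id : X →ₗ[ℂ] X).toPMap ⊤ else S.fracIntegral ω α

/-- The fractional power `(ω - A)^α`: the inverse of the injective operator `(ω - A)^{-α}`. It
differs from `(A - ω)^α` only by the unimodular factor `e^{iπα}`. -/
def fracPow (ω α : ℝ) : X →ₗ.[ℂ] X :=
  (S.negFracPow ω α).inverse

/-- The space `X_α`, i.e. the domain of the fractional power `(ω - A)^α`. -/
abbrev Xα (ω α : ℝ) : Submodule ℂ X :=
  (S.fracPow ω α).domain

/-- The norm `‖x‖_α = ‖(ω - A)^α x‖` of `X_α`. -/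
def normα (ω α : ℝ) (x : S.Xα ω α) : ℝ :=
  ‖S.fracPow ω α x‖

end C0Semigroup

instance fact_two_pi_pos : Fact (0 < 2 * π) := ⟨Real.two_pi_pos⟩

/-- The circle `𝕋 = ℝ / 2πℤ`. -/
abbrev Circ : Type := AddCircle (2 * π)

/-- Normalized Lebesgue measure `dθ / 2π` on the circle. -/
abbrev circMeasure : Measure Circ := AddCircle.haarAddCircle

/-- A quasi-normed function lattice on the circle: a linear space of (classes of) measurable
functions, with a quasi-norm, that is solid: `|f| ≤ |g|` a.e. and `g ∈ F` give `f ∈ F` and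
`‖f‖ ≤ ‖g‖`. -/
structure QuasiNormedLattice where
  carrier : Submodule ℝ (Circ →ₘ[circMeasure] ℝ)
  qnorm : (Circ →ₘ[circMeasure] ℝ) → ℝ
  qnorm_nonneg : ∀ f ∈ carrier, 0 ≤ qnorm f
  qnorm_eq_zero : ∀ f ∈ carrier, qnorm f = 0 ↔ f = 0
  qnorm_smul : ∀ (c : ℝ), ∀ f ∈ carrier, qnorm (c • f) = |c| * qnorm f
  qnorm_add : ∃ C : ℝ, ∀ f ∈ carrier, ∀ g ∈ carrier, qnorm (f + g) ≤ C * (qnorm f + qnorm g)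
  solid : ∀ f g : Circ →ₘ[circMeasure] ℝ, g ∈ carrier →
    (∀ᵐ θ ∂circMeasure, |f θ| ≤ |g θ|) → f ∈ carrier ∧ qnorm f ≤ qnorm g

section Multipliers

variable {X : Type*} [NormedAddCommGroup X] [NormedSpace ℂ X]

/-- The value at `θ` of the trigonometric polynomial `∑_k e^{ikθ} c_k` with coefficients in a
vector space. -/
def trigPoly {V : Type*} [AddCommGroup V] [Module ℂ V] (c : ℤ →₀ V) (θ : Circ) : V :=
  c.sum fun k v => fourier k θ • v

/-- The action `∑_k e^{ikθ} c_k ↦ ∑_k e^{ikθ} m_k c_k` of the multiplier `{m_k}` on trigonometric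
polynomials with coefficients in a subspace `V` of `X`. -/
def multiplierOp {V : Submodule ℂ X} (m : ℤ → X →L[ℂ] X) (c : ℤ →₀ V) (θ : Circ) : X :=
  c.sum fun k v => fourier k θ • m k v

theorem continuous_multiplierOp {V : Submodule ℂ X} (m : ℤ → X →L[ℂ] X) (c : ℤ →₀ V) :
    Continuous (multiplierOp m c) := by
  unfold multiplierOp Finsupp.sum
  fun_prop

/-- The class of the function `θ ↦ ‖(L f)(θ)‖`, where `L` is the multiplier operator and `f` is a
trigonometric polynomial. -/
def multiplierOpNorm {V : Submodule ℂ X} (m : ℤ → X →L[ℂ] X) (c : ℤ →₀ V) :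
    Circ →ₘ[circMeasure] ℝ :=
  AEEqFun.mk (fun θ => ‖multiplierOp m c θ‖)
    (continuous_multiplierOp m c).norm.aestronglyMeasurable

/-- The norm of a trigonometric polynomial with values in `X_α` in the space `L_p(𝕋, X_α)`. -/
def LpαNorm (S : C0Semigroup X) (ω α : ℝ) (p : ℝ≥0∞) (c : ℤ →₀ S.Xα ω α) : ℝ≥0∞ :=
  eLpNorm (fun θ => S.normα ω α (trigPoly c θ)) p circMeasure

/-- `{m_k}` is a multiplier from `L_p(𝕋, X_α)` to `L_p(𝕋, X)`, `1 ≤ p < ∞`: the operator given on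
the (dense) trigonometric polynomials with values in `X_α` is bounded. -/
def IsLpMultiplier (S : C0Semigroup X) (ω α : ℝ) (p : ℝ≥0∞) (m : ℤ → X →L[ℂ] X) : Prop :=
  ∃ C : ℝ≥0, ∀ c : ℤ →₀ S.Xα ω α,
    eLpNorm (multiplierOp m c) p circMeasure ≤ C * LpαNorm S ω α p c

/-- `{m_k}` is a multiplier from `L_1(𝕋, X_α)` to `F(𝕋, X)`, the space of `X`-valued functions `g`
with `‖g(·)‖ ∈ F`, quasi-normed by the quasi-norm of `‖g(·)‖` in `F`. -/
def IsLatticeMultiplier (S : C0Semigroup X) (ω α : ℝ) (F : QuasiNormedLattice)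
    (m : ℤ → X →L[ℂ] X) : Prop :=
  ∃ C : ℝ≥0, ∀ c : ℤ →₀ S.Xα ω α,
    multiplierOpNorm m c ∈ F.carrier ∧
      ENNReal.ofReal (F.qnorm (multiplierOpNorm m c)) ≤ C * LpαNorm S ω α 1 c

end Multipliers

end SemigroupMultiplier

end

open SemigroupMultiplier

noncomputable section

namespace SemigroupMultiplier

/-! ### Orbits, the generator and its resolvent -/

namespace C0Semigroup

variable {X : Type*} [NormedAddCommGroup X] [NormedSpace ℂ X] (S : C0Semigroup X)

/-! Write `D = I - T_{2π}`, `R_k = R(ik)` and `B = (ω - A)^{-α}`, a bounded injective operator with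
range `X_α` that commutes with the semigroup (`exists_negFracPow_clm`). Through `B` everything
becomes a statement about polynomials with values in `X` and the operators `R_k B`; condition 1 says
that the range of `B` lies in the range of `D`.

The link is the identity `∫_0^{2π} e^{-ikt} T_t x dt = D R_k x = R_k D x`: the `R_k D x` are the
Fourier coefficients of an orbit on one period. Fejér's theorem at the jump of that orbit says that
their Cesàro sum is `π (x + T_{2π} x)` (`tendsto_fejerMean_orbitCoeff`). Hence `x = D y` makes `∑
R_k x` summable, and conversely a sum `s` satisfies `D s = π (x + T_{2π} x)`, whence `x = D((s/π +
x)/2)`. The same limit shows that `D` is injective with dense range.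

If condition 1 holds, `G = D⁻¹ B` is bounded by the closed graph theorem. The multiplier operator is
then convolution on one period with the bounded family `T_t G`, so it maps `L_1` into the bounded
functions, and hence every `L_p` into itself. The pairing in the last condition becomes the integral
of `φ(-t)` against a scalar orbit.

Conversely, a multiplier bound of any kind controls the minimum over the circle of `‖L f(θ)‖` by the
uniform norm of `f`. Since `L f` obeys the variation of constants formula (`T_operatorPoly`),
control at one point spreads to all points. Thus `f ↦ L f(0)` is bounded for the uniform norm and
can be evaluated in the limit on a continuous function built from the orbit of `x`; this solves `D y
= B x` (`range_subset_of_bound`).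

The last condition, tested on Fejér kernels, bounds the Cesàro means of `R_k B x` by a multiple of
`‖x‖`. For `x = D w` the known limit gives `‖B w‖ ≤ C ‖D w‖`, and the dense range of `D` finishes
the proof (`range_subset_of_dual_bound`). -/

theorem exists_exp_bound {ω : ℝ} (hω : S.growthBound < (ω : EReal)) :
    ∃ w < ω, ∃ M, 0 < M ∧ ∀ t : ℝ, 0 ≤ t → ‖S.T t‖ ≤ M * Real.exp (w * t) := by
  obtain ⟨r, ⟨w, rfl, M, hM⟩, hr⟩ := sInf_lt_iff.1 hω
  refine ⟨w, by exact_mod_cast hr, max M 1, by positivity, fun t ht => (hM t ht).trans ?_⟩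
  gcongr
  exact le_max_left _ _

theorem exists_bound_Icc {ω : ℝ} (hω : S.growthBound < (ω : EReal)) :
    ∃ M, 0 < M ∧ ∀ t ∈ Icc 0 (2 * π), ‖S.T t‖ ≤ M := by
  obtain ⟨w, -, M, hM, h⟩ := S.exists_exp_bound hω
  refine ⟨M * Real.exp (|w| * (2 * π)), by positivity, fun t ht => (h t ht.1).trans ?_⟩
  gcongr
  · exact ht.1
  · exact le_abs_self w
  · exact ht.2

theorem T_comm {s t : ℝ} (hs : 0 ≤ s) (ht : 0 ≤ t) (x : X) : S.T s (S.T t x) = S.T t (S.T s x) := by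
  rw [← ContinuousLinearMap.comp_apply, ← S.T_add s t hs ht, add_comm, S.T_add t s ht hs,
    ContinuousLinearMap.comp_apply]

theorem T_add_apply {s t : ℝ} (hs : 0 ≤ s) (ht : 0 ≤ t) (x : X) :
    S.T (s + t) x = S.T s (S.T t x) := by
  rw [S.T_add s t hs ht, ContinuousLinearMap.comp_apply]

theorem T_zero_apply (x : X) : S.T 0 x = x := by simp [S.T_zero]

theorem continuousOn_Icc (x : X) (a : ℝ) : ContinuousOn (fun t => S.T t x) (Icc 0 a) :=
  (S.continuousOn x).mono Icc_subset_Ici_self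

variable {S} in
theorem GeneratorRel.map {x y : X} (h : S.GeneratorRel x y) {t : ℝ} (ht : 0 ≤ t) :
    S.GeneratorRel (S.T t x) (S.T t y) := by
  refine (((S.T t).continuous.tendsto y).comp h).congr' ?_
  filter_upwards [self_mem_nhdsWithin] with s hs
  simp only [Function.comp, map_smul, map_sub]
  rw [S.T_comm ht (le_of_lt hs)]

variable {S} in
-- The right derivative comes from the semigroup law alone, and the fundamental theorem of calculus
-- for continuous functions needs no more.
theorem GeneratorRel.hasDerivWithinAt {x y : X} (h : S.GeneratorRel x y) {t : ℝ} (ht : 0 ≤ t) :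
    HasDerivWithinAt (fun s => S.T s x) (S.T t y) (Ioi t) t := by
  rw [hasDerivWithinAt_iff_tendsto_slope' (by simp)]
  have h1 : Tendsto (fun s : ℝ => s - t) (𝓝[>] t) (𝓝[>] 0) := by
    refine tendsto_nhdsWithin_iff.2 ⟨?_, ?_⟩
    · have : Tendsto (fun s : ℝ => s - t) (𝓝 t) (𝓝 (t - t)) := tendsto_id.sub_const t
      rw [sub_self] at this
      exact this.mono_left nhdsWithin_le_nhds
    · filter_upwards [self_mem_nhdsWithin] with s hs
      simpa using hs
  refine ((h.map ht).comp h1).congr' ?_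
  filter_upwards [self_mem_nhdsWithin] with s hs
  have h2 : 0 ≤ s - t := (sub_pos.2 hs).le
  have h3 : S.T s x = S.T (s - t) (S.T t x) := by
    rw [← S.T_add_apply h2 ht, sub_add_cancel]
  simp only [Function.comp, slope, vsub_eq_sub]
  rw [h3, ← Complex.coe_smul, Complex.ofReal_inv]

theorem generatorRel_apply (x : S.generator.domain) : S.GeneratorRel x (S.generator x) :=
  x.2.choose_spec

variable {S} in
theorem GeneratorRel.generator_eq {x y : X} (h : S.GeneratorRel x y) (hx : x ∈ S.generator.domain) :
    S.generator ⟨x, hx⟩ = y :=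
  tendsto_nhds_unique (S.generatorRel_apply ⟨x, hx⟩) h

variable {S} {z : ℂ} {R : X →L[ℂ] X}

theorem resolvent_generatorRel (hR : IsResolventAt S.generator z R) (x : X) :
    S.GeneratorRel (R x) (z • R x - x) := by
  obtain ⟨h, e⟩ := hR.1 x
  have := S.generatorRel_apply ⟨R x, h⟩
  rwa [← sub_sub_cancel (z • R x) (S.generator ⟨R x, h⟩), e] at this

theorem resolvent_comm (hR : IsResolventAt S.generator z R) {t : ℝ} (ht : 0 ≤ t) (x : X) :
    R (S.T t x) = S.T t (R x) := by
  have h := (resolvent_generatorRel hR x).map ht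
  have hm : S.T t (R x) ∈ S.generator.domain := ⟨_, h⟩
  have := hR.2 ⟨_, hm⟩
  rwa [h.generator_eq hm, ← map_smul, ← map_sub, sub_sub_cancel] at this

/-- The function `-e^{-zt} T_t R x` is a primitive of the integrand, because `A R x = z R x - x`. -/
theorem integral_exp_smul [CompleteSpace X] (hR : IsResolventAt S.generator z R) (x : X) {τ : ℝ}
    (hτ : 0 ≤ τ) :
    ∫ t in (0 : ℝ)..τ, Complex.exp (-(z * t)) • S.T t x =
      R x - Complex.exp (-(z * τ)) • S.T τ (R x) := by
  have hder : ∀ t ∈ Ioo 0 τ, HasDerivWithinAt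
      (fun s : ℝ => -(Complex.exp (-(z * s)) • S.T s (R x)))
      (Complex.exp (-(z * t)) • S.T t x) (Ioi t) t := by
    intro t ht
    have h1 := (resolvent_generatorRel hR x).hasDerivWithinAt ht.1.le
    have h2 : HasDerivAt (fun s : ℝ => Complex.exp (-(z * s)))
        (Complex.exp (-(z * t)) * (-(z * 1))) t :=
      ((Complex.ofRealCLM.hasDerivAt (x := t)).const_mul z).neg.cexp
    have h3 := (h2.hasDerivWithinAt (s := Ioi t)).smul h1 |>.neg
    convert! h3 using 1
    rw [map_sub, map_smul, smul_sub, smul_smul]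
    module
  have hc : ContinuousOn (fun t : ℝ => Complex.exp (-(z * t)) ) (Icc 0 τ) := by fun_prop
  rw [intervalIntegral.integral_eq_sub_of_hasDeriv_right_of_le hτ
    (hc.smul (S.continuousOn_Icc _ τ)).neg hder
    (by
      apply ContinuousOn.intervalIntegrable
      rw [uIcc_of_le hτ]
      exact hc.smul (S.continuousOn_Icc _ τ))]
  simp [S.T_zero_apply]
  abel

end C0Semigroup

theorem isResolventAt_res {X : Type*} [NormedAddCommGroup X] [NormedSpace ℂ X] {A : X →ₗ.[ℂ] X}
    {z : ℂ} (hz : z ∈ resSet A) : IsResolventAt A z (res A z) := by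
  have hz' : ∃ R : X →L[ℂ] X, IsResolventAt A z R := hz
  rw [res, dif_pos hz']
  exact hz'.choose_spec

/-! ### Beta integrals and the semigroup law of fractional integrals -/

open ProbabilityTheory in
theorem integral_rpow_mul_sub_rpow {a b u : ℝ} (ha : 0 < a) (hb : 0 < b) (hu : 0 < u) :
    ∫ s in (0 : ℝ)..u, s ^ (a - 1) * (u - s) ^ (b - 1) = beta a b * u ^ (a + b - 1) := by
  have h := Complex.betaIntegral_scaled a b hu
  have h1 : ∫ s in (0 : ℝ)..u, (s : ℂ) ^ ((a : ℂ) - 1) * ((u : ℂ) - s) ^ ((b : ℂ) - 1) =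
      ((∫ s in (0 : ℝ)..u, s ^ (a - 1) * (u - s) ^ (b - 1) : ℝ) : ℂ) := by
    rw [← intervalIntegral.integral_ofReal]
    refine intervalIntegral.integral_congr fun s hs => ?_
    rw [uIcc_of_le hu.le] at hs
    rw [Complex.ofReal_mul, Complex.ofReal_cpow hs.1, Complex.ofReal_cpow (sub_nonneg.2 hs.2)]
    push_cast
    rfl
  have h2 : Complex.betaIntegral a b = (beta a b : ℂ) := by
    rw [Complex.betaIntegral_eq_Gamma_mul_div _ _ (by simpa) (by simpa), beta]
    rw [← Complex.ofReal_add, Complex.Gamma_ofReal, Complex.Gamma_ofReal, Complex.Gamma_ofReal]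
    push_cast
    rfl
  rw [h1, h2, mul_comm] at h
  have h3 : (u : ℂ) ^ ((a : ℂ) + b - 1) = ((u ^ (a + b - 1) : ℝ) : ℂ) := by
    rw [Complex.ofReal_cpow hu.le]
    push_cast
    rfl
  rw [h3] at h
  exact_mod_cast h

theorem integrableOn_rpow_mul_exp_neg {a ε : ℝ} (ha : 0 < a) (hε : 0 < ε) :
    IntegrableOn (fun t : ℝ => t ^ (a - 1) * Real.exp (-(ε * t))) (Ioi 0) := by
  have := integrableOn_rpow_mul_exp_neg_mul_rpow (s := a - 1) (p := 1) (by linarith) one_pos hε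
  simpa using this

section Fractional

variable {X : Type*} [NormedAddCommGroup X] [NormedSpace ℝ X]

/-- The kernel `t₊^(a-1)` of the fractional integral. -/
def rpowKernel (a : ℝ) : ℝ → ℝ := (Ioi (0 : ℝ)).indicator fun t => t ^ (a - 1)

theorem rpowKernel_nonneg (a t : ℝ) : 0 ≤ rpowKernel a t :=
  indicator_nonneg (fun _ ht => Real.rpow_nonneg (le_of_lt ht) _) t

theorem rpowKernel_of_pos {a t : ℝ} (ht : 0 < t) : rpowKernel a t = t ^ (a - 1) :=
  indicator_of_mem ht _

theorem rpowKernel_of_nonpos {a t : ℝ} (ht : t ≤ 0) : rpowKernel a t = 0 :=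
  indicator_of_notMem (by simpa using ht) _

theorem measurable_rpowKernel (a : ℝ) : Measurable (rpowKernel a) :=
  (measurable_id.pow_const _).indicator measurableSet_Ioi

theorem integrable_rpowKernel_mul_exp_neg {a ε : ℝ} (ha : 0 < a) (hε : 0 < ε) :
    Integrable (fun t : ℝ => rpowKernel a t * Real.exp (-(ε * t))) := by
  have := (integrable_indicator_iff measurableSet_Ioi).2 (integrableOn_rpow_mul_exp_neg ha hε)
  refine this.congr (Eventually.of_forall fun t => ?_)
  simp only [rpowKernel, indicator]
  split_ifs <;> simp

theorem integral_rpowKernel_smul (a : ℝ) (g : ℝ → X) :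
    ∫ t, rpowKernel a t • g t = ∫ t in Ioi (0 : ℝ), t ^ (a - 1) • g t := by
  rw [← integral_indicator measurableSet_Ioi]
  congr 1 with t
  simp only [rpowKernel, indicator]
  split_ifs <;> simp

theorem integral_rpowKernel_mul_sub {a b u : ℝ} (ha : 0 < a) (hb : 0 < b) :
    ∫ s, rpowKernel a s * rpowKernel b (u - s) =
      ProbabilityTheory.beta a b * rpowKernel (a + b) u := by
  rcases le_or_gt u 0 with hu | hu
  · rw [rpowKernel_of_nonpos hu, mul_zero]
    refine integral_eq_zero_of_ae (Eventually.of_forall fun s => ?_)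
    rcases le_or_gt s 0 with hs | hs
    · simp [rpowKernel_of_nonpos hs]
    · simp [rpowKernel_of_nonpos (show u - s ≤ 0 by linarith)]
  · rw [rpowKernel_of_pos hu, ← integral_rpow_mul_sub_rpow ha hb hu,
      intervalIntegral.integral_of_le hu.le, integral_Ioc_eq_integral_Ioo,
      ← integral_indicator measurableSet_Ioo]
    congr 1 with s
    by_cases hs : s ∈ Ioo 0 u
    · rw [indicator_of_mem hs, rpowKernel_of_pos hs.1, rpowKernel_of_pos (sub_pos.2 hs.2)]
    · rw [indicator_of_notMem hs]
      rcases le_or_gt s 0 with hs' | hs'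
      · simp [rpowKernel_of_nonpos hs']
      · have : u ≤ s := not_lt.1 fun h => hs ⟨hs', h⟩
        simp [rpowKernel_of_nonpos (show u - s ≤ 0 by linarith)]

/-- The semigroup law of the Weyl fractional integrals of an exponentially decaying function. -/
theorem integral_rpow_smul_integral_rpow_smul [CompleteSpace X] {h : ℝ → X} (hc : Continuous h)
    {M ε : ℝ} (hε : 0 < ε) (hM : ∀ t, 0 ≤ t → ‖h t‖ ≤ M * Real.exp (-(ε * t))) {a b : ℝ}
    (ha : 0 < a) (hb : 0 < b) :
    ∫ s in Ioi (0 : ℝ), s ^ (a - 1) • ∫ t in Ioi (0 : ℝ), t ^ (b - 1) • h (s + t) =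
      ProbabilityTheory.beta a b • ∫ u in Ioi (0 : ℝ), u ^ (a + b - 1) • h u := by
  have hint : Integrable (fun z : ℝ × ℝ =>
      (rpowKernel a z.1 * rpowKernel b z.2) • h (z.1 + z.2)) (volume.prod volume) := by
    refine (((integrable_rpowKernel_mul_exp_neg ha hε).mul_prod
      (integrable_rpowKernel_mul_exp_neg hb hε)).const_mul M).mono' ?_ ?_
    · exact ((((measurable_rpowKernel a).comp measurable_fst).mul
        ((measurable_rpowKernel b).comp measurable_snd)).aestronglyMeasurable).smul
        (hc.comp (continuous_fst.add continuous_snd)).aestronglyMeasurable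
    · refine Eventually.of_forall fun z => ?_
      have h1 := rpowKernel_nonneg a z.1
      have h2 := rpowKernel_nonneg b z.2
      rw [norm_smul, Real.norm_of_nonneg (mul_nonneg h1 h2)]
      rcases le_or_gt z.1 0 with hz | hz
      · simp [rpowKernel_of_nonpos hz]
      rcases le_or_gt z.2 0 with hz' | hz'
      · simp [rpowKernel_of_nonpos hz']
      calc _ ≤ (rpowKernel a z.1 * rpowKernel b z.2) * (M * Real.exp (-(ε * (z.1 + z.2)))) := by
            gcongr
            exact hM _ (by positivity)
        _ = _ := by rw [mul_add, neg_add, Real.exp_add]; ring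
  -- The measure-preserving shear `(s, u) ↦ (s, u - s)` turns `h (s + t)` into `h u`; after Fubini
  -- the inner integral is the convolution of the two kernels.
  have hint' : Integrable (Function.uncurry fun s u : ℝ =>
      (rpowKernel a s * rpowKernel b (u - s)) • h u) (volume.prod volume) := by
    refine ((measurePreserving_prod_sub (volume : Measure ℝ) (volume : Measure ℝ)
      ).integrable_comp_of_integrable hint).congr (Eventually.of_forall fun z => ?_)
    simp [Function.uncurry]
  have hswap := integral_integral_swap hint'
  have hl : ∀ s : ℝ, ∫ u, (rpowKernel a s * rpowKernel b (u - s)) • h u =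
      rpowKernel a s • ∫ t in Ioi (0 : ℝ), t ^ (b - 1) • h (s + t) := by
    intro s
    rw [← integral_rpowKernel_smul b, ← integral_smul]
    rw [← integral_sub_right_eq_self
      (fun t => rpowKernel a s • rpowKernel b t • h (s + t)) s]
    congr 1 with u
    rw [smul_smul, add_sub_cancel]
  have hr : ∀ u : ℝ, ∫ s, (rpowKernel a s * rpowKernel b (u - s)) • h u =
      ProbabilityTheory.beta a b • rpowKernel (a + b) u • h u := by
    intro u
    rw [integral_smul_const, integral_rpowKernel_mul_sub ha hb, smul_smul]
  simp_rw [hl, hr] at hswap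
  rw [integral_rpowKernel_smul, integral_smul, integral_rpowKernel_smul] at hswap
  exact hswap

end Fractional

/-! ### The negative fractional power as a bounded injective operator -/

namespace C0Semigroup

variable {X : Type*} [NormedAddCommGroup X] [NormedSpace ℂ X] (S : C0Semigroup X)

/-- The rescaled orbit `e^{-ωt} T_t x`, extended continuously to negative times. -/
def scaledOrbit (ω : ℝ) (x : X) (t : ℝ) : X := Real.exp (-(ω * t)) • S.T (max t 0) x

theorem continuous_scaledOrbit (ω : ℝ) (x : X) : Continuous (S.scaledOrbit ω x) := by
  have : Continuous fun t : ℝ => S.T (max t 0) x :=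
    (S.continuousOn x).comp_continuous (by fun_prop) fun t => mem_Ici.2 (le_max_right _ _)
  unfold scaledOrbit
  fun_prop

theorem scaledOrbit_add (ω : ℝ) (x : X) {s t : ℝ} (hs : 0 ≤ s) (ht : 0 ≤ t) :
    S.scaledOrbit ω x (s + t) = Real.exp (-(ω * s)) • S.T s (S.scaledOrbit ω x t) := by
  simp only [scaledOrbit]
  rw [max_eq_left ht, max_eq_left (add_nonneg hs ht), S.T_add_apply hs ht,
    (S.T s).map_smul_of_tower, smul_smul, ← Real.exp_add]
  ring_nf

theorem norm_scaledOrbit_le {ω w M : ℝ} (h : ∀ t : ℝ, 0 ≤ t → ‖S.T t‖ ≤ M * Real.exp (w * t))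
    (x : X) (t : ℝ) (ht : 0 ≤ t) :
    ‖S.scaledOrbit ω x t‖ ≤ M * ‖x‖ * Real.exp (-((ω - w) * t)) := by
  rw [scaledOrbit, norm_smul, Real.norm_of_nonneg (Real.exp_pos _).le, max_eq_left ht]
  calc _ ≤ Real.exp (-(ω * t)) * (M * Real.exp (w * t) * ‖x‖) := by
        gcongr
        exact (S.T t).le_of_opNorm_le (h t ht) x
    _ = M * ‖x‖ * (Real.exp (-(ω * t)) * Real.exp (w * t)) := by ring
    _ = _ := by rw [← Real.exp_add]; ring_nf

theorem fracIntegrand_eq (ω a : ℝ) (x : X) {t : ℝ} (ht : 0 < t) :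
    S.fracIntegrand ω a x t = t ^ (a - 1) • S.scaledOrbit ω x t := by
  rw [fracIntegrand, scaledOrbit, Complex.coe_smul, mul_smul, max_eq_left ht.le]

theorem integral_fracIntegrand (ω a : ℝ) (x : X) :
    ∫ t in Ioi (0 : ℝ), S.fracIntegrand ω a x t =
      ∫ t in Ioi (0 : ℝ), t ^ (a - 1) • S.scaledOrbit ω x t :=
  setIntegral_congr_fun measurableSet_Ioi fun _ ht => S.fracIntegrand_eq ω a x ht

theorem norm_rpow_smul_scaledOrbit_le {ω w M : ℝ}
    (h : ∀ t : ℝ, 0 ≤ t → ‖S.T t‖ ≤ M * Real.exp (w * t)) (a : ℝ) (x : X) {t : ℝ} (ht : 0 < t) :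
    ‖t ^ (a - 1) • S.scaledOrbit ω x t‖ ≤
      M * ‖x‖ * (t ^ (a - 1) * Real.exp (-((ω - w) * t))) := by
  have h0 : 0 ≤ t ^ (a - 1) := Real.rpow_nonneg ht.le _
  rw [norm_smul, Real.norm_of_nonneg h0]
  calc _ ≤ t ^ (a - 1) * (M * ‖x‖ * Real.exp (-((ω - w) * t))) := by
        gcongr
        exact S.norm_scaledOrbit_le h x t ht.le
    _ = _ := by ring

theorem integrableOn_rpow_smul_scaledOrbit {ω w M : ℝ} (hw : w < ω)
    (h : ∀ t : ℝ, 0 ≤ t → ‖S.T t‖ ≤ M * Real.exp (w * t)) {a : ℝ} (ha : 0 < a) (x : X) :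
    IntegrableOn (fun t : ℝ => t ^ (a - 1) • S.scaledOrbit ω x t) (Ioi 0) := by
  refine ((integrableOn_rpow_mul_exp_neg ha (sub_pos.2 hw)).const_mul (M * ‖x‖)).mono' ?_ ?_
  · exact (measurable_id.pow_const (a - 1)).aestronglyMeasurable.smul
      (S.continuous_scaledOrbit ω x).aestronglyMeasurable
  · filter_upwards [ae_restrict_mem measurableSet_Ioi] with t ht
    exact S.norm_rpow_smul_scaledOrbit_le h a x ht

theorem fracIntegral_domain_eq_top {ω w M : ℝ} (hw : w < ω)
    (h : ∀ t : ℝ, 0 ≤ t → ‖S.T t‖ ≤ M * Real.exp (w * t)) {a : ℝ} (ha : 0 < a) :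
    (S.fracIntegral ω a).domain = ⊤ :=
  eq_top_iff.2 fun x _ => (S.integrableOn_rpow_smul_scaledOrbit hw h ha x).congr_fun
    (fun _ ht => (S.fracIntegrand_eq ω a x ht).symm) measurableSet_Ioi

/-- The unnormalized fractional integral of the rescaled orbit of `x`. -/
def orbitIntegral (ω a : ℝ) (x : X) : X := ∫ t in Ioi (0 : ℝ), t ^ (a - 1) • S.scaledOrbit ω x t

theorem norm_orbitIntegral_le {ω w M : ℝ} (hw : w < ω)
    (h : ∀ t : ℝ, 0 ≤ t → ‖S.T t‖ ≤ M * Real.exp (w * t)) {a : ℝ} (ha : 0 < a) (x : X) :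
    ‖S.orbitIntegral ω a x‖ ≤
      M * (∫ t in Ioi (0 : ℝ), t ^ (a - 1) * Real.exp (-((ω - w) * t))) * ‖x‖ := by
  have := norm_integral_le_of_norm_le (μ := volume.restrict (Ioi (0 : ℝ)))
    (f := fun t => t ^ (a - 1) • S.scaledOrbit ω x t)
    ((integrableOn_rpow_mul_exp_neg ha (sub_pos.2 hw)).const_mul (M * ‖x‖))
    (by
      filter_upwards [ae_restrict_mem measurableSet_Ioi] with t ht
      exact S.norm_rpow_smul_scaledOrbit_le h a x ht)
  rw [integral_const_mul] at this
  exact this.trans_eq (by ring)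

theorem scaled_T_orbitIntegral [CompleteSpace X] {ω w M : ℝ} (hw : w < ω)
    (h : ∀ t : ℝ, 0 ≤ t → ‖S.T t‖ ≤ M * Real.exp (w * t)) {a : ℝ} (ha : 0 < a) (x : X) {s : ℝ}
    (hs : 0 ≤ s) :
    Real.exp (-(ω * s)) • S.T s (S.orbitIntegral ω a x) =
      ∫ t in Ioi (0 : ℝ), t ^ (a - 1) • S.scaledOrbit ω x (s + t) := by
  rw [orbitIntegral, ← ContinuousLinearMap.integral_comp_comm _
    (S.integrableOn_rpow_smul_scaledOrbit hw h ha x), ← integral_smul]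
  refine setIntegral_congr_fun measurableSet_Ioi fun t ht => ?_
  rw [S.scaledOrbit_add ω x hs (le_of_lt ht), (S.T s).map_smul_of_tower, smul_comm]

theorem T_orbitIntegral [CompleteSpace X] {ω w M : ℝ} (hw : w < ω)
    (h : ∀ t : ℝ, 0 ≤ t → ‖S.T t‖ ≤ M * Real.exp (w * t)) {a : ℝ} (ha : 0 < a) (x : X) {s : ℝ}
    (hs : 0 ≤ s) : S.orbitIntegral ω a (S.T s x) = S.T s (S.orbitIntegral ω a x) := by
  rw [orbitIntegral, orbitIntegral, ← ContinuousLinearMap.integral_comp_comm _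
    (S.integrableOn_rpow_smul_scaledOrbit hw h ha x)]
  refine setIntegral_congr_fun measurableSet_Ioi fun t ht => ?_
  simp only [scaledOrbit]
  rw [(S.T s).map_smul_of_tower, (S.T s).map_smul_of_tower, S.T_comm hs (le_max_right _ _)]

theorem orbitIntegral_orbitIntegral [CompleteSpace X] {ω w M : ℝ} (hw : w < ω)
    (h : ∀ t : ℝ, 0 ≤ t → ‖S.T t‖ ≤ M * Real.exp (w * t)) {a b : ℝ} (ha : 0 < a) (hb : 0 < b)
    (x : X) :
    S.orbitIntegral ω a (S.orbitIntegral ω b x) =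
      ProbabilityTheory.beta a b • S.orbitIntegral ω (a + b) x := by
  have h1 := integral_rpow_smul_integral_rpow_smul (S.continuous_scaledOrbit ω x)
    (sub_pos.2 hw) (S.norm_scaledOrbit_le h x) ha hb
  rw [orbitIntegral, orbitIntegral, orbitIntegral, ← h1]
  refine setIntegral_congr_fun measurableSet_Ioi fun s hs => ?_
  rw [← S.scaled_T_orbitIntegral hw h hb x (le_of_lt hs), scaledOrbit, max_eq_left (le_of_lt hs)]
  rfl

/-- Applying the rescaled `T_s` to the vanishing integral gives the tail from `s`, which therefore
vanishes too. So `∫_0^s` vanishes for all `s ≥ 0`, and its derivative at `0` is `x`. -/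
theorem eq_zero_of_orbitIntegral_one [CompleteSpace X] {ω w M : ℝ} (hw : w < ω)
    (h : ∀ t : ℝ, 0 ≤ t → ‖S.T t‖ ≤ M * Real.exp (w * t)) {x : X}
    (hx : S.orbitIntegral ω 1 x = 0) : x = 0 := by
  have hint : IntegrableOn (S.scaledOrbit ω x) (Ioi 0) := by
    simpa using S.integrableOn_rpow_smul_scaledOrbit hw h one_pos x
  have h0 : ∫ t in Ioi (0 : ℝ), S.scaledOrbit ω x t = 0 := by simpa [orbitIntegral] using hx
  have hzero : ∀ s ∈ Ici (0 : ℝ), ∫ t in (0 : ℝ)..s, S.scaledOrbit ω x t = 0 := by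
    intro s hs
    have h1 := S.scaled_T_orbitIntegral hw h one_pos x hs
    rw [hx, map_zero, smul_zero] at h1
    simp only [sub_self, Real.rpow_zero, one_smul] at h1
    have h2 : ∫ t in Ioi (0 : ℝ), S.scaledOrbit ω x (s + t) =
        ∫ t in Ioi s, S.scaledOrbit ω x t := by
      rw [← integral_indicator measurableSet_Ioi, ← integral_indicator measurableSet_Ioi,
        ← integral_add_left_eq_self ((Ioi s).indicator _) s]
      congr 1 with t
      simp [indicator]
    rw [← intervalIntegral.integral_Ioi_sub_Ioi hint hs, h0, ← h2, ← h1, sub_zero]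
  have hd := (S.continuous_scaledOrbit ω x).integral_hasStrictDerivAt 0 0
    |>.hasDerivAt.hasDerivWithinAt (s := Ici 0)
  have hd' : HasDerivWithinAt (fun s => ∫ t in (0 : ℝ)..s, S.scaledOrbit ω x t) 0 (Ici 0) 0 :=
    (hasDerivWithinAt_const (0 : ℝ) (Ici 0) (0 : X)).congr hzero (hzero 0 self_mem_Ici)
  have := (uniqueDiffWithinAt_Ici (0 : ℝ)).eq_deriv _ hd hd'
  simpa [scaledOrbit, S.T_zero_apply] using this

/-- By the semigroup law, a zero of the integral of order `a` is a zero of that of any integer order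
`n + 1 > a`, and integer orders reduce to order one by induction. -/
theorem eq_zero_of_orbitIntegral_eq_zero [CompleteSpace X] {ω w M : ℝ} (hw : w < ω)
    (h : ∀ t : ℝ, 0 ≤ t → ‖S.T t‖ ≤ M * Real.exp (w * t)) {a : ℝ} (ha : 0 < a) {x : X}
    (hx : S.orbitIntegral ω a x = 0) : x = 0 := by
  have hz : ∀ b, S.orbitIntegral ω b (0 : X) = 0 := fun b => by simp [orbitIntegral, scaledOrbit]
  have hnat : ∀ n : ℕ, S.orbitIntegral ω (n + 1) x = 0 → x = 0 := by
    intro n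
    induction n with
    | zero => simpa using S.eq_zero_of_orbitIntegral_one hw h
    | succ n ih =>
      intro hn
      refine ih (S.eq_zero_of_orbitIntegral_one hw h ?_)
      rw [S.orbitIntegral_orbitIntegral hw h one_pos (by positivity), add_comm (1 : ℝ)]
      push_cast at hn
      rw [hn, smul_zero]
  obtain ⟨n, hn⟩ := exists_nat_gt a
  have hb : 0 < (n : ℝ) + 1 - a := by linarith
  refine hnat n ?_
  have h1 := S.orbitIntegral_orbitIntegral hw h hb ha x
  rw [hx, hz, sub_add_cancel] at h1
  exact (smul_eq_zero.1 h1.symm).resolve_left (ProbabilityTheory.beta_pos hb ha).ne'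

/-- The negative fractional power is a bounded injective operator commuting with the semigroup,
whose range is `X_α`. -/
theorem exists_negFracPow_clm [CompleteSpace X] {ω α : ℝ} (hα : 0 ≤ α)
    (hω : S.growthBound < (ω : EReal)) :
    ∃ B : X →L[ℂ] X, Function.Injective B ∧
      (∀ t, 0 ≤ t → ∀ x, B (S.T t x) = S.T t (B x)) ∧
      (S.Xα ω α : Set X) = range B ∧ ∀ v : S.Xα ω α, B (S.fracPow ω α v) = v := by
  suffices H : (S.negFracPow ω α).domain = ⊤ ∧ ∃ B : X →L[ℂ] X, Function.Injective B ∧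
      (∀ t, 0 ≤ t → ∀ x, B (S.T t x) = S.T t (B x)) ∧
      ∀ x : (S.negFracPow ω α).domain, S.negFracPow ω α x = B x by
    obtain ⟨hd, B, hB, hT, h⟩ := H
    have hr : (S.Xα ω α : Set X) = range B := by
      rw [Xα, fracPow, LinearPMap.inverse_domain]
      ext y
      constructor
      · rintro ⟨x, rfl⟩
        exact ⟨x, (h x).symm⟩
      · rintro ⟨x, rfl⟩
        exact ⟨⟨x, hd ▸ Submodule.mem_top⟩, h _⟩
    refine ⟨B, hB, hT, hr, fun v => ?_⟩
    have hk : (S.negFracPow ω α).toFun.ker = ⊥ := by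
      refine LinearMap.ker_eq_bot'.2 fun x hx => ?_
      have h2 : B x = B 0 := by rw [map_zero, ← h x]; exact hx
      exact Subtype.ext (hB h2)
    have hv : (v : X) ∈ range B := hr ▸ v.2
    obtain ⟨x, hx⟩ := hv
    have hxd : x ∈ (S.negFracPow ω α).domain := hd ▸ Submodule.mem_top
    have h3 : S.fracPow ω α v = x :=
      LinearPMap.inverse_apply_eq hk (x := ⟨x, hxd⟩) ((h ⟨x, hxd⟩).trans hx)
    rw [h3, hx]
  rcases hα.eq_or_lt with rfl | hα
  · refine ⟨by simp [negFracPow], ContinuousLinearMap.id ℂ X, Function.injective_id,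
      fun _ _ _ => rfl, ?_⟩
    rw [negFracPow, if_pos rfl]
    exact fun _ => rfl
  · obtain ⟨w, hw, M, -, hM⟩ := S.exists_exp_bound hω
    have hd := S.fracIntegral_domain_eq_top hw hM hα
    have hneg : S.negFracPow ω α = S.fracIntegral ω α := by rw [negFracPow, if_neg hα.ne']
    rw [hneg]
    have happ : ∀ x : (S.fracIntegral ω α).domain,
        S.fracIntegral ω α x = ((Real.Gamma α)⁻¹ : ℂ) • S.orbitIntegral ω α x := by
      intro x
      rw [orbitIntegral, ← integral_fracIntegrand]
      rfl
    have hmem : ∀ x : X, x ∈ (S.fracIntegral ω α).domain := fun x => hd ▸ Submodule.mem_top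
    let L : X →ₗ[ℂ] X := (S.fracIntegral ω α).toFun ∘ₗ
      (LinearMap.id.codRestrict (S.fracIntegral ω α).domain hmem)
    have hL : ∀ x, L x = ((Real.Gamma α)⁻¹ : ℂ) • S.orbitIntegral ω α x :=
      fun x => happ ⟨x, hmem x⟩
    have hΓ : ((Real.Gamma α)⁻¹ : ℂ) ≠ 0 :=
      inv_ne_zero (Complex.ofReal_ne_zero.2 (Real.Gamma_pos_of_pos hα).ne')
    refine ⟨hd, L.mkContinuous (‖((Real.Gamma α)⁻¹ : ℂ)‖ *
      (M * (∫ t in Ioi (0 : ℝ), t ^ (α - 1) * Real.exp (-((ω - w) * t))))) fun x => ?_, ?_, ?_, ?_⟩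
    · rw [hL, norm_smul, mul_assoc]
      gcongr
      exact S.norm_orbitIntegral_le hw hM hα x
    · refine (injective_iff_map_eq_zero _).2 fun x hx => ?_
      have hx' : L x = 0 := hx
      rw [hL] at hx'
      exact S.eq_zero_of_orbitIntegral_eq_zero hw hM hα ((smul_eq_zero.1 hx').resolve_left hΓ)
    · intro t ht x
      change L (S.T t x) = S.T t (L x)
      rw [hL, hL, S.T_orbitIntegral hw hM hα x ht, map_smul]
    · exact fun x => rfl

end C0Semigroup

/-! ### Fejér means and Fejér's theorem with vector values -/

section Fejer

/-- The Fejér mean `N⁻¹ ∑_{j, l < N} u (j - l)` of a doubly infinite series. -/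
def fejerMean {V : Type*} [AddCommGroup V] [Module ℂ V] (u : ℤ → V) (N : ℕ) : V :=
  (N : ℂ)⁻¹ • ∑ j ∈ Finset.range N, ∑ l ∈ Finset.range N, u ((j : ℤ) - l)

/-- The right side is the border added when the square of pairs `(j, l)` grows from side `N` to `N +
1`: the new column carries the negative indices, the new row the others. -/
theorem sum_Icc_neg_eq {V : Type*} [AddCommGroup V] (u : ℤ → V) (N : ℕ) :
    ∑ k ∈ Finset.Icc (-(N : ℤ)) N, u k =
      ∑ j ∈ Finset.range N, u ((j : ℤ) - N) + ∑ l ∈ Finset.range (N + 1), u ((N : ℤ) - l) := by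
  induction N with
  | zero => simp
  | succ N ih =>
    have h : Finset.Icc (-((N + 1 : ℕ) : ℤ)) ((N + 1 : ℕ) : ℤ) =
        insert (-((N + 1 : ℕ) : ℤ)) (insert ((N + 1 : ℕ) : ℤ) (Finset.Icc (-(N : ℤ)) N)) := by
      ext k
      simp only [Finset.mem_insert, Finset.mem_Icc]
      omega
    rw [h, Finset.sum_insert (by simp only [Finset.mem_insert, Finset.mem_Icc]; omega),
      Finset.sum_insert (by simp only [Finset.mem_Icc]; omega), ih,
      Finset.sum_range_succ' (fun j : ℕ => u ((j : ℤ) - ((N + 1 : ℕ) : ℤ))) N,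
      Finset.sum_range_succ' (fun l : ℕ => u (((N + 1 : ℕ) : ℤ) - l)) (N + 1)]
    simp only [Nat.cast_add, Nat.cast_one, add_sub_add_right_eq_sub, Nat.cast_zero, sub_zero,
      zero_sub]
    abel

theorem sum_range_sum_Icc {V : Type*} [AddCommGroup V] (u : ℤ → V) (N : ℕ) :
    ∑ n ∈ Finset.range N, ∑ k ∈ Finset.Icc (-(n : ℤ)) n, u k =
      ∑ j ∈ Finset.range N, ∑ l ∈ Finset.range N, u ((j : ℤ) - l) := by
  induction N with
  | zero => simp
  | succ N ih =>
    rw [Finset.sum_range_succ, ih, Finset.sum_range_succ _ N, sum_Icc_neg_eq]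
    simp_rw [Finset.sum_range_succ _ N]
    rw [Finset.sum_add_distrib]
    abel

theorem integrable_of_continuous {E : Type*} [NormedAddCommGroup E] {H : Circ → E} (hH : Continuous H) :
    Integrable H circMeasure :=
  hH.integrable_of_hasCompactSupport (HasCompactSupport.of_compactSpace H)

/-- A Korovkin-type estimate: `1 - cos t` vanishes only at `0`, so by compactness it has a positive
minimum away from `0`, while near `0` uniform continuity suffices. It reduces Fejér's theorem to the
integrals of the kernel against `1` and `cos`. -/
theorem norm_sub_le_add_mul_one_sub_re {E : Type*} [NormedAddCommGroup E] {H : Circ → E} (hH : Continuous H) {ε : ℝ} (hε : 0 < ε) :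
    ∃ C, 0 ≤ C ∧ ∀ θ t : Circ, ‖H (θ - t) - H θ‖ ≤ ε + C * (1 - (fourier 1 t : ℂ).re) := by
  have hle : ∀ t : Circ, (fourier 1 t : ℂ).re ≤ 1 := fun t =>
    (Complex.re_le_norm _).trans (by rw [fourier_apply, Circle.norm_coe])
  obtain ⟨δ, hδ, h⟩ := Metric.uniformContinuous_iff.1
    (CompactSpace.uniformContinuous_of_continuous hH) ε hε
  obtain ⟨D, hD⟩ := isCompact_univ.exists_bound_of_continuousOn hH.continuousOn
  have hD0 : 0 ≤ D := (norm_nonneg _).trans (hD 0 trivial)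
  have hK : IsCompact {t : Circ | δ ≤ ‖t‖} :=
    (isClosed_le continuous_const continuous_norm).isCompact
  have hm : ∃ m, 0 < m ∧ ∀ t : Circ, δ ≤ ‖t‖ → m ≤ 1 - (fourier 1 t : ℂ).re := by
    rcases Set.eq_empty_or_nonempty {t : Circ | δ ≤ ‖t‖} with he | hne
    · exact ⟨1, one_pos, fun t ht => absurd (show t ∈ {t : Circ | δ ≤ ‖t‖} from ht) (by simp [he])⟩
    · obtain ⟨t₀, ht₀, hmin⟩ := hK.exists_isMinOn hne
        (f := fun t : Circ => 1 - (fourier 1 t : ℂ).re) (by fun_prop)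
      refine ⟨_, ?_, fun t ht => hmin ht⟩
      refine lt_of_le_of_ne (sub_nonneg.2 (hle t₀)) fun h0 => ?_
      have hre : (fourier 1 t₀ : ℂ).re = 1 := by linarith
      have hn : ‖(fourier 1 t₀ : ℂ)‖ = 1 := by rw [fourier_apply, Circle.norm_coe]
      have h1 : (fourier 1 t₀ : ℂ) = 1 := by
        have hsq := Complex.sq_norm (fourier 1 t₀ : ℂ)
        rw [hn, Complex.normSq_apply, hre] at hsq
        refine Complex.ext hre ?_
        simpa using hsq
      rw [fourier_one] at h1
      have h2 : AddCircle.toCircle t₀ = AddCircle.toCircle (0 : Circ) := by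
        rw [AddCircle.toCircle_zero]
        exact Circle.ext (by simpa using h1)
      have h3 : t₀ = 0 := AddCircle.injective_toCircle Real.two_pi_pos.ne' h2
      have h4 : δ ≤ ‖t₀‖ := ht₀
      rw [h3, norm_zero] at h4
      linarith
  obtain ⟨m, hm0, hm⟩ := hm
  refine ⟨2 * D / m, by positivity, fun θ t => ?_⟩
  have hw : 0 ≤ 1 - (fourier 1 t : ℂ).re := sub_nonneg.2 (hle t)
  rcases lt_or_ge ‖t‖ δ with ht | ht
  · have := h (show dist (θ - t) θ < δ by simpa [dist_eq_norm] using ht)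
    rw [dist_eq_norm] at this
    have h0 : 0 ≤ 2 * D / m * (1 - (fourier 1 t : ℂ).re) := by positivity
    linarith
  · calc ‖H (θ - t) - H θ‖ ≤ D + D := (norm_sub_le _ _).trans (add_le_add (hD _ trivial) (hD _ trivial))
      _ = 2 * D / m * m := by field_simp; ring
      _ ≤ 2 * D / m * (1 - (fourier 1 t : ℂ).re) := by gcongr; exact hm t ht
      _ ≤ _ := by linarith

variable {X : Type*} [NormedAddCommGroup X] [NormedSpace ℂ X]

theorem cesaroSummable_iff (u : ℤ → X) :
    CesaroSummable u ↔ ∃ s : X, Tendsto (fejerMean u) atTop (𝓝 s) := by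
  simp only [CesaroSummable, sum_range_sum_Icc]
  rfl

theorem fejerMean_map {V W : Type*} [AddCommGroup V] [Module ℂ V] [AddCommGroup W] [Module ℂ W]
    (L : V →ₗ[ℂ] W) (u : ℤ → V) (N : ℕ) : fejerMean (fun k => L (u k)) N = L (fejerMean u N) := by
  simp [fejerMean, map_sum]

theorem fejerMean_const_smul {V : Type*} [AddCommGroup V] [Module ℂ V] (c : ℂ) (u : ℤ → V)
    (N : ℕ) : fejerMean (fun k => c • u k) N = c • fejerMean u N := by
  simp only [fejerMean, ← Finset.smul_sum]
  rw [smul_comm]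

theorem fejerMean_add {V : Type*} [AddCommGroup V] [Module ℂ V] (u v : ℤ → V) (N : ℕ) :
    fejerMean (fun k => u k + v k) N = fejerMean u N + fejerMean v N := by
  simp only [fejerMean, Finset.sum_add_distrib, smul_add]

theorem fejerMean_neg {V : Type*} [AddCommGroup V] [Module ℂ V] (u : ℤ → V) (N : ℕ) :
    fejerMean (fun k => u (-k)) N = fejerMean u N := by
  simp only [fejerMean]
  rw [Finset.sum_comm]
  simp only [neg_sub]

/-- The Fejér kernel. -/
def fejerKernel (N : ℕ) (t : Circ) : ℝ :=
  (N : ℝ)⁻¹ * Complex.normSq (∑ j ∈ Finset.range N, fourier (j : ℤ) t)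

theorem fejerKernel_nonneg (N : ℕ) (t : Circ) : 0 ≤ fejerKernel N t := by
  have := Complex.normSq_nonneg (∑ j ∈ Finset.range N, fourier (j : ℤ) t)
  unfold fejerKernel
  positivity

theorem continuous_fejerKernel (N : ℕ) : Continuous (fejerKernel N) := by
  unfold fejerKernel
  exact continuous_const.mul (Complex.continuous_normSq.comp (by fun_prop))

theorem fejerKernel_eq (N : ℕ) (t : Circ) :
    (fejerKernel N t : ℂ) = fejerMean (fun k => fourier k t) N := by
  rw [fejerKernel, fejerMean, Complex.ofReal_mul, ← Complex.mul_conj, map_sum, Finset.sum_mul_sum]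
  simp only [sub_eq_add_neg, fourier_add, fourier_neg, smul_eq_mul]
  push_cast
  rfl

theorem integral_fejerMean_smul {H : Circ → X} (hH : Continuous H) (N : ℕ) :
    ∫ t, (fejerKernel N t : ℂ) • H t ∂circMeasure =
      fejerMean (fun k => ∫ t, fourier k t • H t ∂circMeasure) N := by
  have hi : ∀ k : ℤ, Integrable (fun t : Circ => fourier k t • H t) circMeasure := fun k =>
    integrable_of_continuous (by fun_prop)
  simp only [fejerKernel_eq, fejerMean, smul_assoc, Finset.sum_smul]
  rw [integral_smul, integral_finsetSum _ fun j _ => integrable_finsetSum _ fun l _ => hi _]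
  congr 1
  refine Finset.sum_congr rfl fun j _ => ?_
  rw [integral_finsetSum _ fun l _ => hi _]

theorem integral_fejerKernel_smul_sub {H : Circ → X} (hH : Continuous H) (N : ℕ) (θ : Circ) :
    ∫ t, (fejerKernel N t : ℂ) • H (θ - t) ∂circMeasure =
      fejerMean (fun k => fourier k θ • fourierCoeff H k) N := by
  rw [integral_fejerMean_smul (H := fun t => H (θ - t)) (by fun_prop)]
  congr 1
  funext k
  rw [← integral_sub_left_eq_self _ circMeasure θ, fourierCoeff, ← integral_smul]
  congr 1 with t
  rw [sub_sub_cancel, smul_smul]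
  congr 1
  rw [fourier_apply, fourier_apply, fourier_apply, smul_sub, sub_eq_add_neg, AddCircle.toCircle_add,
    neg_smul, Circle.coe_mul]

theorem integral_fourier (k : ℤ) : ∫ t : Circ, fourier k t ∂circMeasure = if k = 0 then 1 else 0 := by
  have := congrFun (fourierCoeff_fourier (T := 2 * π) k) 0
  simp only [fourierCoeff, neg_zero, fourier_zero, one_smul] at this
  rw [this, Pi.single_apply]
  simp [eq_comm]

theorem integral_fejerKernel {N : ℕ} (hN : N ≠ 0) : ∫ t, fejerKernel N t ∂circMeasure = 1 := by
  have h := integral_fejerMean_smul (H := fun _ => (1 : ℂ)) continuous_const N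
  simp only [smul_eq_mul, mul_one, integral_fourier, fejerMean, sub_eq_zero, Nat.cast_inj] at h
  have h2 : ∀ j ∈ Finset.range N, ∑ l ∈ Finset.range N, (if j = l then (1 : ℂ) else 0) = 1 := by
    intro j hj
    rw [Finset.sum_ite_eq, if_pos hj]
  rw [Finset.sum_congr rfl h2, integral_complex_ofReal] at h
  have h3 : (N : ℂ) ≠ 0 := by exact_mod_cast hN
  simp [h3] at h
  exact_mod_cast h

theorem integral_fejerKernel_mul_fourier_one {N : ℕ} (hN : N ≠ 0) :
    ∫ t, (fejerKernel N t : ℂ) * fourier 1 t ∂circMeasure = 1 - (N : ℂ)⁻¹ := by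
  have h := integral_fejerMean_smul (H := fun t => fourier 1 t) (by fun_prop) N
  simp only [smul_eq_mul, ← fourier_add, integral_fourier, fejerMean] at h
  obtain ⟨n, rfl⟩ := Nat.exists_eq_succ_of_ne_zero hN
  have h2 : ∀ j ∈ Finset.range n, ∑ l ∈ Finset.range (n + 1),
      (if (j : ℤ) - l + 1 = 0 then (1 : ℂ) else 0) = 1 := by
    intro j hj
    have : ∀ l ∈ Finset.range (n + 1), (if (j : ℤ) - l + 1 = 0 then (1 : ℂ) else 0) =
        if j + 1 = l then 1 else 0 := fun l _ => by
      congr 1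
      exact propext (by omega)
    rw [Finset.sum_congr rfl this, Finset.sum_ite_eq, if_pos]
    simpa using hj
  have h3 : ∑ l ∈ Finset.range (n + 1), (if (n : ℤ) - l + 1 = 0 then (1 : ℂ) else 0) = 0 := by
    refine Finset.sum_eq_zero fun l hl => if_neg ?_
    rw [Finset.mem_range] at hl
    omega
  rw [Nat.succ_eq_add_one, Finset.sum_range_succ, h3, Finset.sum_congr rfl h2] at h
  rw [Nat.succ_eq_add_one, h]
  have h4 : ((n : ℂ) + 1) ≠ 0 := by exact_mod_cast Nat.succ_ne_zero n
  simp
  field_simp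
  ring

theorem integral_fejerKernel_mul_one_sub {N : ℕ} (hN : N ≠ 0) :
    ∫ t : Circ, fejerKernel N t * (1 - (fourier 1 t : ℂ).re) ∂circMeasure = (N : ℝ)⁻¹ := by
  have hc := continuous_fejerKernel N
  have h := congrArg Complex.re (integral_fejerKernel_mul_fourier_one hN)
  have hi : Integrable (fun t : Circ => (fejerKernel N t : ℂ) * fourier 1 t) circMeasure :=
    integrable_of_continuous (by fun_prop)
  rw [← Complex.reCLM_apply, ← Complex.reCLM.integral_comp_comm hi] at h
  simp only [Complex.reCLM_apply, Complex.re_ofReal_mul] at h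
  simp only [mul_sub, mul_one]
  rw [integral_sub (integrable_of_continuous hc) (integrable_of_continuous (by fun_prop)),
    integral_fejerKernel hN, h]
  simp

/-- Fejér's theorem for vector-valued continuous functions on the circle. -/
theorem fejer_uniform [CompleteSpace X] {H : Circ → X} (hH : Continuous H) {ε : ℝ} (hε : 0 < ε) :
    ∀ᶠ N in atTop, ∀ θ, ‖fejerMean (fun k => fourier k θ • fourierCoeff H k) N - H θ‖ ≤ ε := by
  obtain ⟨C, hC, hb⟩ := norm_sub_le_add_mul_one_sub_re hH (half_pos hε)
  have hlim : Tendsto (fun N : ℕ => C * (N : ℝ)⁻¹) atTop (𝓝 0) := by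
    simpa using tendsto_inv_atTop_nhds_zero_nat.const_mul C
  filter_upwards [hlim.eventually (gt_mem_nhds (half_pos hε)), eventually_ne_atTop 0]
    with N hN hN0 θ
  have hK := continuous_fejerKernel N
  have h1 : H θ = ∫ t, (fejerKernel N t : ℂ) • H θ ∂circMeasure := by
    rw [integral_smul_const, integral_complex_ofReal, integral_fejerKernel hN0]
    simp
  rw [← integral_fejerKernel_smul_sub hH]
  rw [congrArg (fun y => ‖_ - y‖) h1, ← integral_sub (integrable_of_continuous (by fun_prop))
    (integrable_of_continuous (by fun_prop))]
  simp only [← smul_sub]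
  calc _ ≤ ∫ t : Circ, (ε / 2 * fejerKernel N t +
        C * (fejerKernel N t * (1 - (fourier 1 t : ℂ).re))) ∂circMeasure := by
        refine norm_integral_le_of_norm_le (integrable_of_continuous (by fun_prop))
          (Eventually.of_forall fun t => ?_)
        rw [norm_smul, Complex.norm_real, Real.norm_of_nonneg (fejerKernel_nonneg N t)]
        calc _ ≤ fejerKernel N t * (ε / 2 + C * (1 - (fourier 1 t : ℂ).re)) :=
              mul_le_mul_of_nonneg_left (hb θ t) (fejerKernel_nonneg N t)
          _ = _ := by ring
    _ = ε / 2 + C * (N : ℝ)⁻¹ := by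
        rw [integral_add (integrable_of_continuous (by fun_prop))
          (integrable_of_continuous (by fun_prop)), integral_const_mul, integral_const_mul,
          integral_fejerKernel hN0, integral_fejerKernel_mul_one_sub hN0, mul_one]
    _ ≤ ε := by linarith

theorem tendsto_fejerMean_fourierCoeff [CompleteSpace X] {H : Circ → X} (hH : Continuous H) :
    Tendsto (fejerMean (fourierCoeff H)) atTop (𝓝 (H 0)) := by
  refine Metric.tendsto_nhds.2 fun ε hε => ?_
  filter_upwards [fejer_uniform hH (half_pos hε)] with N hN
  have := hN 0
  simp only [fourier_eval_zero, one_smul] at this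
  rw [dist_eq_norm]
  linarith [this]

end Fejer

/-! ### Fourier coefficients of orbits and the range of `I - T_{2π}` -/

theorem fourier_coe_circ (k : ℤ) (t : ℝ) :
    fourier k (t : Circ) = Complex.exp ((k : ℂ) * Complex.I * t) := by
  rw [fourier_coe_apply]
  congr 1
  have : (π : ℂ) ≠ 0 := by exact_mod_cast Real.pi_ne_zero
  push_cast
  field_simp

theorem norm_fourier_apply (k : ℤ) (t : Circ) : ‖(fourier k t : ℂ)‖ = 1 := by
  rw [fourier_apply, Circle.norm_coe]

theorem fourier_sub_apply (k : ℤ) (s t : Circ) :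
    (fourier k (s - t) : ℂ) = fourier k s * fourier (-k) t := by
  rw [fourier_apply, fourier_apply, fourier_apply, smul_sub, sub_eq_add_neg, AddCircle.toCircle_add,
    neg_smul, Circle.coe_mul]

theorem liftIco_coe_of_mem_Icc {E : Type*} {g : ℝ → E} (hg : g 0 = g (2 * π)) {t : ℝ}
    (ht : t ∈ Icc 0 (2 * π)) : AddCircle.liftIco (2 * π) 0 g (t : Circ) = g t := by
  rcases ht.2.eq_or_lt with rfl | h
  · rw [AddCircle.coe_period, ← hg]
    exact AddCircle.liftIco_zero_coe_apply (x := 0) ⟨le_rfl, Real.two_pi_pos⟩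
  · exact AddCircle.liftIco_zero_coe_apply ⟨ht.1, h⟩

theorem integral_circMeasure {E : Type*} [NormedAddCommGroup E] [NormedSpace ℝ E] (f : Circ → E) :
    (2 * π) • ∫ θ, f θ ∂circMeasure = ∫ t in (0 : ℝ)..2 * π, f (t : Circ) := by
  rw [AddCircle.integral_haarAddCircle, smul_inv_smul₀ Real.two_pi_pos.ne']
  simpa using (AddCircle.intervalIntegral_preimage (2 * π) 0 f).symm

namespace C0Semigroup

variable {X : Type*} [NormedAddCommGroup X] [NormedSpace ℂ X] (S : C0Semigroup X)

/-- The Fourier coefficient `∫_0^{2π} e^{-ikt} T_t y dt` of an orbit. -/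
def orbitCoeff (y : X) (k : ℤ) : X :=
  ∫ t in (0 : ℝ)..2 * π, (fourier (-k) (t : Circ) : ℂ) • S.T t y

theorem continuous_fourier_coe (k : ℤ) : Continuous fun t : ℝ => (fourier k (t : Circ) : ℂ) :=
  (fourier k).continuous.comp (AddCircle.continuous_mk' _)

theorem continuousOn_T_sub (y : X) : ContinuousOn (fun t => S.T (2 * π - t) y) (Icc 0 (2 * π)) :=
  (S.continuousOn_Icc y (2 * π)).comp (f := fun t => 2 * π - t) (by fun_prop) fun t ht =>
    ⟨sub_nonneg.2 ht.2, sub_le_self _ ht.1⟩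

theorem intervalIntegrable_of_continuousOn {E : Type*} [NormedAddCommGroup E] {g : ℝ → E}
    (hg : ContinuousOn g (Icc 0 (2 * π))) : IntervalIntegrable g volume 0 (2 * π) := by
  refine ContinuousOn.intervalIntegrable ?_
  rwa [uIcc_of_le Real.two_pi_pos.le]

theorem orbitCoeff_eq_integral_sub (y : X) (k : ℤ) :
    S.orbitCoeff y (-k) =
      ∫ t in (0 : ℝ)..2 * π, (fourier (-k) (t : Circ) : ℂ) • S.T (2 * π - t) y := by
  have := intervalIntegral.integral_comp_sub_left (a := 0) (b := 2 * π)
    (fun t : ℝ => (fourier k (t : Circ) : ℂ) • S.T t y) (2 * π)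
  rw [sub_self, sub_zero] at this
  rw [orbitCoeff, neg_neg, ← this]
  congr 1 with t
  rw [AddCircle.coe_sub, fourier_sub_apply, AddCircle.coe_period, fourier_eval_zero, one_mul]

/-- The orbit itself jumps at the period. Adding its reflection `T_{2π - t} y` gives a continuous
periodic function with value `y + T_{2π} y` at `0`, and Fejér means do not see the reflection `k ↦
-k`. -/
theorem tendsto_fejerMean_orbitCoeff [CompleteSpace X] (y : X) :
    Tendsto (fejerMean (S.orbitCoeff y)) atTop (𝓝 ((π : ℂ) • (y + S.T (2 * π) y))) := by
  set g : ℝ → X := fun t => S.T t y + S.T (2 * π - t) y with hg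
  have hgc : ContinuousOn g (Icc 0 (2 * π)) :=
    (S.continuousOn_Icc y _).add (S.continuousOn_T_sub y)
  have hg0 : g 0 = g (2 * π) := by simp [hg, add_comm]
  have hH := AddCircle.liftIco_zero_continuous hg0 hgc
  have h2 : ∀ k, S.orbitCoeff y k + S.orbitCoeff y (-k) =
      (2 * π : ℂ) • fourierCoeff (AddCircle.liftIco (2 * π) 0 g) k := by
    intro k
    have hc := (continuous_fourier_coe (-k)).continuousOn (s := Icc 0 (2 * π))
    have hi₁ : IntervalIntegrable (fun t : ℝ => (fourier (-k) (t : Circ) : ℂ) • S.T t y) volume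
        0 (2 * π) := intervalIntegrable_of_continuousOn (hc.smul (S.continuousOn_Icc y _))
    have hi₂ : IntervalIntegrable (fun t : ℝ => (fourier (-k) (t : Circ) : ℂ) • S.T (2 * π - t) y)
        volume 0 (2 * π) := intervalIntegrable_of_continuousOn (hc.smul (S.continuousOn_T_sub y))
    rw [orbitCoeff_eq_integral_sub, orbitCoeff, ← intervalIntegral.integral_add hi₁ hi₂]
    have h3 := integral_circMeasure
      fun t => (fourier (-k) t : ℂ) • AddCircle.liftIco (2 * π) 0 g t
    rw [← Complex.coe_smul] at h3
    push_cast at h3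
    rw [fourierCoeff, h3]
    refine intervalIntegral.integral_congr fun t ht => ?_
    rw [uIcc_of_le Real.two_pi_pos.le] at ht
    rw [liftIco_coe_of_mem_Icc hg0 ht, ← smul_add]
  have hlim := (tendsto_fejerMean_fourierCoeff hH).const_smul (π : ℂ)
  have h0 : AddCircle.liftIco (2 * π) 0 g (0 : Circ) = y + S.T (2 * π) y := by
    have := liftIco_coe_of_mem_Icc hg0 (t := 0) ⟨le_rfl, Real.two_pi_pos.le⟩
    rw [AddCircle.coe_zero] at this
    rw [this]
    simp [hg, S.T_zero_apply]
  rw [h0] at hlim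
  refine hlim.congr fun N => ?_
  have h4 := fejerMean_add (S.orbitCoeff y) (fun k => S.orbitCoeff y (-k)) N
  rw [fejerMean_neg, funext h2, fejerMean_const_smul, mul_smul, ← two_smul ℂ] at h4
  exact smul_right_injective X (two_ne_zero (α := ℂ)) h4

variable {S} {R : ℤ → X →L[ℂ] X}

theorem orbitCoeff_eq_sub [CompleteSpace X] {k : ℤ} {R : X →L[ℂ] X}
    (hR : IsResolventAt S.generator ((k : ℂ) * Complex.I) R) (x : X) :
    S.orbitCoeff x k = R x - S.T (2 * π) (R x) := by
  have h := integral_exp_smul hR x Real.two_pi_pos.le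
  have h1 : ∀ t : ℝ, Complex.exp (-((k : ℂ) * Complex.I * t)) = fourier (-k) (t : Circ) := by
    intro t
    rw [fourier_coe_circ]
    push_cast
    ring_nf
  simp only [h1] at h
  rw [AddCircle.coe_period, fourier_eval_zero, one_smul] at h
  exact h

theorem orbitCoeff_eq_map_sub [CompleteSpace X] {k : ℤ} {R : X →L[ℂ] X}
    (hR : IsResolventAt S.generator ((k : ℂ) * Complex.I) R) (x : X) :
    S.orbitCoeff x k = R (x - S.T (2 * π) x) := by
  rw [orbitCoeff_eq_sub hR, map_sub, resolvent_comm hR Real.two_pi_pos.le]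

theorem tendsto_fejerMean_resolvent [CompleteSpace X]
    (hR : ∀ k : ℤ, IsResolventAt S.generator ((k : ℂ) * Complex.I) (R k)) (y : X) :
    Tendsto (fejerMean fun k => R k (y - S.T (2 * π) y)) atTop
      (𝓝 ((π : ℂ) • (y + S.T (2 * π) y))) := by
  simpa only [← orbitCoeff_eq_map_sub (hR _)] using S.tendsto_fejerMean_orbitCoeff y

theorem mem_range_iff_cesaroSummable [CompleteSpace X]
    (hR : ∀ k : ℤ, IsResolventAt S.generator ((k : ℂ) * Complex.I) (R k)) (x : X) :
    x ∈ range (fun y : X => y - S.T (2 * π) y) ↔ CesaroSummable fun k => R k x := by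
  rw [cesaroSummable_iff]
  constructor
  · rintro ⟨y, rfl⟩
    exact ⟨_, tendsto_fejerMean_resolvent hR y⟩
  · rintro ⟨s, hs⟩
    let D : X →L[ℂ] X := ContinuousLinearMap.id ℂ X - S.T (2 * π)
    have h1 : Tendsto (fun N => D (fejerMean (fun k => R k x) N)) atTop (𝓝 (D s)) :=
      (D.continuous.tendsto s).comp hs
    have h2 : ∀ N, D (fejerMean (fun k => R k x) N) = fejerMean (S.orbitCoeff x) N := by
      intro N
      rw [← ContinuousLinearMap.coe_coe D, ← fejerMean_map]
      congr 1
      funext k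
      exact (orbitCoeff_eq_sub (hR k) x).symm
    simp only [h2] at h1
    have h3 := tendsto_nhds_unique h1 (S.tendsto_fejerMean_orbitCoeff x)
    have hπ : (π : ℂ) ≠ 0 := by exact_mod_cast Real.pi_ne_zero
    -- Here `D s = π (x + T_{2π} x)`; adding `D x = x - T_{2π} x` to `D s / π` gives `2 x`.
    refine ⟨(2 : ℂ)⁻¹ • ((π : ℂ)⁻¹ • s + x), ?_⟩
    change D ((2 : ℂ)⁻¹ • ((π : ℂ)⁻¹ • s + x)) = x
    rw [map_smul, map_add, map_smul, h3, inv_smul_smul₀ hπ, inv_smul_eq_iff₀ two_ne_zero,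
      two_smul]
    simp [D]

theorem injective_sub_T [CompleteSpace X]
    (hR : ∀ k : ℤ, IsResolventAt S.generator ((k : ℂ) * Complex.I) (R k)) {y : X}
    (hy : y - S.T (2 * π) y = 0) : y = 0 := by
  have h := tendsto_fejerMean_resolvent hR y
  have hπ : (π : ℂ) ≠ 0 := by exact_mod_cast Real.pi_ne_zero
  simp only [hy, map_zero] at h
  have h0 : fejerMean (fun _ => (0 : X)) = fun _ => 0 := by
    funext N
    simp [fejerMean]
  rw [h0] at h
  have h1 := tendsto_nhds_unique h tendsto_const_nhds
  rw [← sub_eq_zero.1 hy, ← two_smul ℂ, smul_smul] at h1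
  exact (smul_eq_zero.1 h1).resolve_left (mul_ne_zero hπ two_ne_zero)

/-- A functional that kills the range of `D` kills every orbit coefficient `D R_k x`, hence also the
limit `π (x + T_{2π} x)`. Since it agrees at `x` and `T_{2π} x`, it kills `x`. -/
theorem dense_range_sub_T [CompleteSpace X]
    (hR : ∀ k : ℤ, IsResolventAt S.generator ((k : ℂ) * Complex.I) (R k)) :
    DenseRange fun y : X => y - S.T (2 * π) y := by
  let D : X →L[ℂ] X := ContinuousLinearMap.id ℂ X - S.T (2 * π)
  have hπ : (π : ℂ) ≠ 0 := by exact_mod_cast Real.pi_ne_zero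
  change DenseRange D
  rw [DenseRange, ← ContinuousLinearMap.coe_coe, ← LinearMap.coe_range,
    Submodule.dense_iff_topologicalClosure_eq_top]
  by_contra hne
  obtain ⟨x, hx⟩ : ∃ x, x ∉ (LinearMap.range (D : X →ₗ[ℂ] X)).topologicalClosure := by
    by_contra! hall
    exact hne (eq_top_iff.2 fun x _ => hall x)
  set V := (LinearMap.range (D : X →ₗ[ℂ] X)).topologicalClosure with hV
  have hVc : IsClosed (V : Set X) := Submodule.isClosed_topologicalClosure _
  -- Hahn–Banach on the quotient by the closed range: a functional that is nonzero on the class of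
  -- `x`.
  obtain ⟨q, hq⟩ := SeparatingDual.exists_ne_zero (R := ℂ) (x := V.mkQL x)
    (by simpa using hx)
  set f : X →L[ℂ] ℂ := q.comp V.mkQL with hf
  have hD : ∀ y, f (D y) = 0 := fun y => by
    have h1 : D y ∈ V := Submodule.le_topologicalClosure _ (LinearMap.mem_range_self _ y)
    have h2 : V.mkQL (D y) = 0 := by simpa using h1
    rw [hf, ContinuousLinearMap.comp_apply, h2, map_zero]
  have h := (f.continuous.tendsto _).comp (S.tendsto_fejerMean_orbitCoeff x)
  have h0 : f ∘ fejerMean (S.orbitCoeff x) = fun _ => 0 := by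
    funext N
    have := fejerMean_map (f : X →ₗ[ℂ] ℂ) (S.orbitCoeff x) N
    rw [Function.comp, ← ContinuousLinearMap.coe_coe, ← this]
    have h1 : ∀ k, (f : X →ₗ[ℂ] ℂ) (S.orbitCoeff x k) = 0 := fun k => by
      rw [orbitCoeff_eq_sub (hR k)]
      exact hD (R k x)
    simp [fejerMean, h1]
  rw [h0] at h
  have h1 := tendsto_nhds_unique h tendsto_const_nhds
  have h2 : f x = f (S.T (2 * π) x) := by
    have := hD x
    rw [sub_apply, map_sub] at this
    exact sub_eq_zero.1 this
  rw [map_smul, map_add, ← h2, ← two_smul ℂ, smul_smul] at h1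
  exact hq ((smul_eq_zero.1 h1).resolve_left (mul_ne_zero hπ two_ne_zero))

end C0Semigroup

/-! ### Trigonometric polynomials and the multiplier operator -/

section TrigPoly

variable {X : Type*} [NormedAddCommGroup X] [NormedSpace ℂ X]

/-- The trigonometric polynomial `∑_k e^{ikθ} R_k B z_k`. -/
def operatorPoly (R : ℤ → X →L[ℂ] X) (B : X →L[ℂ] X) (θ : Circ) : (ℤ →₀ X) →ₗ[ℂ] X :=
  Finsupp.lsum ℂ fun k => (fourier k θ : ℂ) • ((R k).comp B : X →ₗ[ℂ] X)

theorem operatorPoly_apply (R : ℤ → X →L[ℂ] X) (B : X →L[ℂ] X) (θ : Circ) (z : ℤ →₀ X) :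
    operatorPoly R B θ z = z.sum fun k v => (fourier k θ : ℂ) • R k (B v) := by
  rw [operatorPoly, Finsupp.lsum_apply]
  rfl

theorem trigPoly_eq_operatorPoly (θ : Circ) (z : ℤ →₀ X) :
    trigPoly z θ = operatorPoly (fun _ => ContinuousLinearMap.id ℂ X) (ContinuousLinearMap.id ℂ X)
      θ z := by
  rw [operatorPoly_apply]
  rfl

theorem continuous_operatorPoly (R : ℤ → X →L[ℂ] X) (B : X →L[ℂ] X) (z : ℤ →₀ X) :
    Continuous fun θ => operatorPoly R B θ z := by
  simp only [operatorPoly_apply, Finsupp.sum]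
  fun_prop

theorem continuous_trigPoly (z : ℤ →₀ X) : Continuous (trigPoly z) := by
  simp only [funext fun θ => trigPoly_eq_operatorPoly θ z]
  exact continuous_operatorPoly _ _ z

theorem trigPoly_sub (z z' : ℤ →₀ X) (θ : Circ) :
    trigPoly (z - z') θ = trigPoly z θ - trigPoly z' θ := by
  simp only [trigPoly_eq_operatorPoly, map_sub]

theorem trigPoly_fejerMean (a : ℤ → X) (N : ℕ) (θ : Circ) :
    trigPoly (fejerMean (fun k => Finsupp.single k (a k)) N) θ =
      fejerMean (fun k => (fourier k θ : ℂ) • a k) N := by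
  rw [trigPoly_eq_operatorPoly, ← fejerMean_map]
  congr 1
  funext k
  rw [operatorPoly_apply, Finsupp.sum_single_index (by simp)]
  rfl

end TrigPoly

namespace C0Semigroup

variable {X : Type*} [NormedAddCommGroup X] [NormedSpace ℂ X] {S : C0Semigroup X}
  {R : ℤ → X →L[ℂ] X} {B : X →L[ℂ] X} {ω α : ℝ}

theorem fracPow_apply_of_eq (hB : Function.Injective B)
    (hBf : ∀ v : S.Xα ω α, B (S.fracPow ω α v) = v) {v : S.Xα ω α} {x : X} (h : B x = v) :
    S.fracPow ω α v = x :=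
  hB ((hBf v).trans h.symm)

theorem normα_trigPoly (c : ℤ →₀ S.Xα ω α) (θ : Circ) :
    S.normα ω α (trigPoly c θ) =
      ‖trigPoly (c.mapRange (S.fracPow ω α) (S.fracPow ω α).map_zero) θ‖ := by
  rw [normα, trigPoly, trigPoly, Finsupp.sum_mapRange_index (by simp)]
  congr 1
  change (S.fracPow ω α).toFun _ = _
  rw [map_finsuppSum]
  refine Finsupp.sum_congr fun k _ => ?_
  rw [map_smul]
  rfl

theorem multiplierOp_eq_operatorPoly (hBf : ∀ v : S.Xα ω α, B (S.fracPow ω α v) = v)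
    (c : ℤ →₀ S.Xα ω α) (θ : Circ) :
    multiplierOp R c θ =
      operatorPoly R B θ (c.mapRange (S.fracPow ω α) (S.fracPow ω α).map_zero) := by
  rw [multiplierOp, operatorPoly_apply, Finsupp.sum_mapRange_index (by simp)]
  exact Finsupp.sum_congr fun k _ => by rw [hBf]

/-- Every polynomial with values in `X` arises from one with values in `X_α`, so bounds on the
latter may be tested on arbitrary coefficients in `X`. -/
theorem exists_mapRange_fracPow (hB : Function.Injective B)
    (hBf : ∀ v : S.Xα ω α, B (S.fracPow ω α v) = v) (hr : (S.Xα ω α : Set X) = range B)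
    (z : ℤ →₀ X) :
    ∃ c : ℤ →₀ S.Xα ω α, c.mapRange (S.fracPow ω α) (S.fracPow ω α).map_zero = z := by
  have hm : ∀ x, B x ∈ S.Xα ω α := fun x => by
    rw [← SetLike.mem_coe, hr]
    exact mem_range_self x
  refine ⟨z.mapRange (fun x => ⟨B x, hm x⟩) (by simp), Finsupp.ext fun k => ?_⟩
  simp only [Finsupp.mapRange_apply]
  exact fracPow_apply_of_eq hB hBf rfl

theorem LpαNorm_eq (p : ℝ≥0∞) (c : ℤ →₀ S.Xα ω α) :
    LpαNorm S ω α p c = eLpNorm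
      (trigPoly (c.mapRange (S.fracPow ω α) (S.fracPow ω α).map_zero)) p circMeasure := by
  simp only [LpαNorm, normα_trigPoly]
  exact eLpNorm_norm _

theorem LpαNorm_le_of_forall_norm_le {p : ℝ≥0∞} {c : ℤ →₀ S.Xα ω α} {D : ℝ}
    (hD : ∀ θ, ‖trigPoly (c.mapRange (S.fracPow ω α) (S.fracPow ω α).map_zero) θ‖ ≤ D) :
    LpαNorm S ω α p c ≤ ENNReal.ofReal D := by
  rw [LpαNorm_eq]
  refine (eLpNorm_le_of_ae_bound (Eventually.of_forall hD)).trans ?_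
  simp

/-- If `(I - T_{2π}) G = B`, the multiplier operator is a convolution with the orbits of `G`. -/
theorem operatorPoly_eq_integral [CompleteSpace X]
    (hR : ∀ k : ℤ, IsResolventAt S.generator ((k : ℂ) * Complex.I) (R k)) {G : X →L[ℂ] X}
    (hG : ∀ x, G x - S.T (2 * π) (G x) = B x) (z : ℤ →₀ X) (θ : Circ) :
    operatorPoly R B θ z = ∫ t in (0 : ℝ)..2 * π, S.T t (G (trigPoly z (θ - t))) := by
  have h1 : ∀ t : ℝ, S.T t (G (trigPoly z (θ - t))) =
      ∑ k ∈ z.support, (fourier k θ : ℂ) • (fourier (-k) (t : Circ) : ℂ) • S.T t (G (z k)) := by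
    intro t
    simp only [trigPoly, Finsupp.sum, map_sum, map_smul, fourier_sub_apply, mul_smul]
  simp only [h1]
  rw [intervalIntegral.integral_finsetSum, operatorPoly_apply, Finsupp.sum]
  · refine Finset.sum_congr rfl fun k _ => ?_
    rw [intervalIntegral.integral_smul, ← hG, ← orbitCoeff_eq_map_sub (hR k)]
    rfl
  · intro k _
    exact intervalIntegrable_of_continuousOn (((continuous_fourier_coe (-k)).continuousOn.smul
      (S.continuousOn_Icc _ _)).const_smul _)

theorem norm_operatorPoly_le [CompleteSpace X]
    (hR : ∀ k : ℤ, IsResolventAt S.generator ((k : ℂ) * Complex.I) (R k)) {M : ℝ}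
    (hM : ∀ t ∈ Icc 0 (2 * π), ‖S.T t‖ ≤ M) {G : X →L[ℂ] X}
    (hG : ∀ x, G x - S.T (2 * π) (G x) = B x) (z : ℤ →₀ X) (θ : Circ) :
    ‖operatorPoly R B θ z‖ ≤ M * ‖G‖ * (2 * π) * ∫ θ, ‖trigPoly z θ‖ ∂circMeasure := by
  have hc := continuous_trigPoly z
  have hcoe : Continuous fun t : ℝ => (t : Circ) := AddCircle.continuous_mk' _
  have h1 : ∫ t in (0 : ℝ)..2 * π, M * ‖G‖ * ‖trigPoly z (θ - t)‖ =
      M * ‖G‖ * (2 * π) * ∫ θ, ‖trigPoly z θ‖ ∂circMeasure := by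
    have h2 := integral_circMeasure fun t => ‖trigPoly z (θ - t)‖
    rw [integral_sub_left_eq_self (fun t => ‖trigPoly z t‖) circMeasure θ] at h2
    rw [intervalIntegral.integral_const_mul, ← h2, smul_eq_mul]
    ring
  rw [operatorPoly_eq_integral hR hG, ← h1]
  refine intervalIntegral.norm_integral_le_of_norm_le Real.two_pi_pos.le
    (Eventually.of_forall fun t ht => ?_) (Continuous.intervalIntegrable (by fun_prop) _ _)
  have ht' := hM t ⟨ht.1.le, ht.2⟩
  calc _ ≤ M * ‖G (trigPoly z (θ - t))‖ := (S.T t).le_of_opNorm_le ht' _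
    _ ≤ M * (‖G‖ * ‖trigPoly z (θ - t)‖) := by
        gcongr
        · exact (norm_nonneg _).trans ht'
        · exact G.le_opNorm _
    _ = _ := by ring

/-- The multiplier operator solves the inhomogeneous Cauchy problem. -/
theorem T_operatorPoly [CompleteSpace X]
    (hR : ∀ k : ℤ, IsResolventAt S.generator ((k : ℂ) * Complex.I) (R k)) (z : ℤ →₀ X) (s : Circ)
    {τ : ℝ} (hτ : 0 ≤ τ) :
    S.T τ (operatorPoly R B s z) = operatorPoly R B (s + (τ : Circ)) z -
      ∫ t in (0 : ℝ)..τ, S.T t (B (trigPoly z (s + (τ : Circ) - t))) := by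
  have h1 : ∀ t : ℝ, S.T t (B (trigPoly z (s + (τ : Circ) - t))) =
      ∑ k ∈ z.support,
        (fourier k (s + (τ : Circ)) : ℂ) • (fourier (-k) (t : Circ) : ℂ) • S.T t (B (z k)) := by
    intro t
    simp only [trigPoly, Finsupp.sum, map_sum, map_smul, fourier_sub_apply, mul_smul]
  simp only [h1]
  rw [intervalIntegral.integral_finsetSum]
  · simp only [operatorPoly_apply, Finsupp.sum]
    rw [← Finset.sum_sub_distrib, map_sum]
    refine Finset.sum_congr rfl fun k _ => ?_
    have h2 := integral_exp_smul (hR k) (B (z k)) hτ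
    have h3 : ∀ t : ℝ, Complex.exp (-((k : ℂ) * Complex.I * t)) = fourier (-k) (t : Circ) := by
      intro t
      rw [fourier_coe_circ]
      push_cast
      ring_nf
    simp only [h3] at h2
    rw [intervalIntegral.integral_smul, h2, ← smul_sub, sub_sub_cancel, map_smul, smul_smul,
      ← fourier_sub_apply, add_sub_cancel_right]
  · intro k _
    refine ContinuousOn.intervalIntegrable ?_
    rw [uIcc_of_le hτ]
    exact ((continuous_fourier_coe (-k)).continuousOn.smul (S.continuousOn_Icc _ _)).const_smul _

theorem norm_T_map_le {M D : ℝ} (hM : ∀ t ∈ Icc 0 (2 * π), ‖S.T t‖ ≤ M) {t : ℝ}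
    (ht : t ∈ Icc 0 (2 * π)) {x : X} (hx : ‖x‖ ≤ D) : ‖S.T t (B x)‖ ≤ M * ‖B‖ * D := by
  have ht' := hM t ht
  calc _ ≤ M * ‖B x‖ := (S.T t).le_of_opNorm_le ht' _
    _ ≤ M * (‖B‖ * D) := by
        gcongr
        · exact (norm_nonneg _).trans ht'
        · exact B.le_opNorm_of_le hx
    _ = _ := by ring

/-- Every `θ` is reached from `s` in a time `τ < 2π`, and the variation of constants formula carries
the value at `s` to `θ` at the cost of an integral over at most one period. -/
theorem norm_operatorPoly_le_of_norm_le [CompleteSpace X]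
    (hR : ∀ k : ℤ, IsResolventAt S.generator ((k : ℂ) * Complex.I) (R k)) {M : ℝ}
    (hM : ∀ t ∈ Icc 0 (2 * π), ‖S.T t‖ ≤ M) {z : ℤ →₀ X} {D : ℝ} (hD : ∀ θ, ‖trigPoly z θ‖ ≤ D)
    (s θ : Circ) :
    ‖operatorPoly R B θ z‖ ≤ M * ‖operatorPoly R B s z‖ + M * ‖B‖ * D * (2 * π) := by
  obtain ⟨τ, hτ, hτs⟩ : ∃ τ ∈ Ico (0 : ℝ) (2 * π), (τ : Circ) = θ - s := by
    have := AddCircle.coe_image_Ico_eq (2 * π) 0 ▸ mem_univ (θ - s)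
    simpa using this
  have h := T_operatorPoly (B := B) hR z s hτ.1
  rw [hτs, add_sub_cancel] at h
  rw [← sub_add_cancel (operatorPoly R B θ z)
    (∫ t in (0 : ℝ)..τ, S.T t (B (trigPoly z (θ - t)))), ← h]
  have hD0 : 0 ≤ D := (norm_nonneg _).trans (hD 0)
  have hM0 : 0 ≤ M := (norm_nonneg _).trans (hM 0 ⟨le_rfl, Real.two_pi_pos.le⟩)
  refine (norm_add_le _ _).trans (add_le_add ?_ ?_)
  · exact (S.T τ).le_of_opNorm_le (hM τ ⟨hτ.1, hτ.2.le⟩) _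
  · refine (intervalIntegral.norm_integral_le_of_norm_le_const (C := M * ‖B‖ * D)
      fun t ht => ?_).trans ?_
    · rw [uIoc_of_le hτ.1] at ht
      exact norm_T_map_le hM ⟨ht.1.le, ht.2.trans hτ.2.le⟩ (hD _)
    · rw [sub_zero, abs_of_nonneg hτ.1]
      gcongr
      exact hτ.2.le

/-- A bound for the multiplier operator on trigonometric polynomials in the uniform norm, at one
point only, puts the range of `B` into the range of `I - T_{2π}`. -/
theorem range_subset_of_bound [CompleteSpace X]
    (hR : ∀ k : ℤ, IsResolventAt S.generator ((k : ℂ) * Complex.I) (R k))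
    (hBT : ∀ t, 0 ≤ t → ∀ x, B (S.T t x) = S.T t (B x)) {M : ℝ}
    (hM : ∀ t ∈ Icc 0 (2 * π), ‖S.T t‖ ≤ M) {C : ℝ}
    (hC : ∀ (z : ℤ →₀ X) (D : ℝ), (∀ θ, ‖trigPoly z θ‖ ≤ D) →
      ∃ s, ‖operatorPoly R B s z‖ ≤ C * D) (x : X) :
    B x ∈ range fun y : X => y - S.T (2 * π) y := by
  have hπ := Real.two_pi_pos
  have hM0 : 0 ≤ M := (norm_nonneg _).trans (hM 0 ⟨le_rfl, hπ.le⟩)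
  set C' := M * C + M * ‖B‖ * (2 * π) with hC'
  have hsup : ∀ (z : ℤ →₀ X) (D : ℝ), (∀ θ, ‖trigPoly z θ‖ ≤ D) →
      ‖operatorPoly R B 0 z‖ ≤ C' * D := by
    intro z D hD
    obtain ⟨s, hs⟩ := hC z D hD
    calc _ ≤ _ := norm_operatorPoly_le_of_norm_le hR hM hD s 0
      _ ≤ M * (C * D) + M * ‖B‖ * D * (2 * π) := by gcongr
      _ = _ := by rw [hC']; ring
  -- The weight vanishes at both ends, which makes the orbit continuous on the circle; it must also
  -- have a nonzero integral `c₀`.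
  set h : ℝ → X := fun t => (t * (2 * π - t)) • S.T t x with hh
  have h0 : h 0 = h (2 * π) := by simp [hh]
  have hHc : Continuous (AddCircle.liftIco (2 * π) 0 h) := by
    refine AddCircle.liftIco_zero_continuous h0 ?_
    have hp : Continuous fun t : ℝ => t * (2 * π - t) := by fun_prop
    exact hp.continuousOn.smul (S.continuousOn_Icc x _)
  set H := AddCircle.liftIco (2 * π) 0 h with hH
  set z : ℕ → ℤ →₀ X := fun N => fejerMean (fun k => Finsupp.single k (fourierCoeff H k)) N with hz
  have happ : ∀ ε > 0, ∃ N₀, ∀ N ≥ N₀, ∀ θ, ‖trigPoly (z N) θ - H θ‖ ≤ ε := by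
    intro ε hε
    obtain ⟨N₀, hN₀⟩ := eventually_atTop.1 (fejer_uniform hHc hε)
    refine ⟨N₀, fun N hN θ => ?_⟩
    rw [hz, trigPoly_fejerMean]
    exact hN₀ N hN θ
  have hcauchy : CauchySeq fun N => operatorPoly R B 0 (z N) := by
    refine Metric.cauchySeq_iff'.2 fun ε hε => ?_
    have hδ : 0 < ε / (2 * (|C'| + 1)) := by positivity
    obtain ⟨N₀, hN₀⟩ := happ _ hδ
    refine ⟨N₀, fun N hN => ?_⟩
    rw [dist_eq_norm, ← map_sub]
    have := hsup (z N - z N₀) (ε / (2 * (|C'| + 1)) + ε / (2 * (|C'| + 1))) fun θ => by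
      rw [trigPoly_sub, ← sub_sub_sub_cancel_right _ _ (H θ)]
      exact (norm_sub_le _ _).trans (add_le_add (hN₀ N hN θ) (hN₀ N₀ le_rfl θ))
    refine this.trans_lt ?_
    have hpos : 0 < |C'| + 1 := by positivity
    calc _ ≤ |C'| * (ε / (2 * (|C'| + 1)) + ε / (2 * (|C'| + 1))) := by
          gcongr
          exact le_abs_self _
      _ = ε * (|C'| / (|C'| + 1)) := by field_simp; ring
      _ < ε * 1 := by
          gcongr
          rw [div_lt_one hpos]
          linarith
      _ = ε := mul_one _
  obtain ⟨u, hu⟩ := cauchySeq_tendsto_of_complete hcauchy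
  -- Over a full period the variation of constants formula returns to the starting point and so
  -- computes `D` of the value at `0`.
  have hid : ∀ N, operatorPoly R B 0 (z N) - S.T (2 * π) (operatorPoly R B 0 (z N)) =
      ∫ t in (0 : ℝ)..2 * π, S.T t (B (trigPoly (z N) (-t))) := by
    intro N
    have := T_operatorPoly (B := B) hR (z N) 0 hπ.le
    rw [AddCircle.coe_period, add_zero] at this
    simp only [zero_sub] at this
    rw [this, sub_sub_cancel]
  set c₀ : ℝ := ∫ t in (0 : ℝ)..2 * π, t * (2 * π - t) with hc₀
  have hc₀pos : 0 < c₀ := by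
    refine intervalIntegral.intervalIntegral_pos_of_pos_on
      (Continuous.intervalIntegrable (by fun_prop) _ _) (fun t ht => ?_) hπ
    exact mul_pos ht.1 (sub_pos.2 ht.2)
  -- On the circle `-t` is `2π - t`, and `T_t T_{2π - t} = T_{2π}`: only the scalar weight still
  -- depends on `t`.
  have hval : ∀ t ∈ Icc 0 (2 * π), S.T t (B (H (-t))) =
      (t * (2 * π - t)) • S.T (2 * π) (B x) := by
    intro t ht
    have ht' : 2 * π - t ∈ Icc 0 (2 * π) := ⟨sub_nonneg.2 ht.2, sub_le_self _ ht.1⟩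
    have h1 : (-(t : Circ)) = ((2 * π - t : ℝ) : Circ) := by
      rw [AddCircle.coe_sub, AddCircle.coe_period, zero_sub]
    rw [h1, hH, liftIco_coe_of_mem_Icc h0 ht', hh]
    simp only
    rw [B.map_smul_of_tower, (S.T t).map_smul_of_tower, hBT _ ht'.1, ← S.T_add_apply ht.1 ht'.1,
      add_sub_cancel, sub_sub_cancel, mul_comm]
  -- Strong continuity and the uniform bound `M` together give continuity when the operator and the
  -- vector both vary.
  have hint : ∀ g : Circ → X, Continuous g →
      IntervalIntegrable (fun t : ℝ => S.T t (B (g (-t)))) volume 0 (2 * π) := by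
    intro g hg
    refine intervalIntegrable_of_continuousOn fun t ht => ?_
    have hBg : Continuous fun t : ℝ => B (g (-(t : Circ))) :=
      B.continuous.comp (hg.comp (AddCircle.continuous_mk' (2 * π)).neg)
    refine tendsto_iff_norm_sub_tendsto_zero.2 ?_
    have hl : Tendsto (fun s : ℝ => M * ‖B (g (-(s : Circ))) - B (g (-(t : Circ)))‖ +
        ‖S.T s (B (g (-(t : Circ)))) - S.T t (B (g (-(t : Circ))))‖) (𝓝[Icc 0 (2 * π)] t)
        (𝓝 (M * 0 + 0)) := by
      refine Tendsto.add (Tendsto.const_mul _ ?_) ?_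
      · exact tendsto_iff_norm_sub_tendsto_zero.1
          ((hBg.tendsto t).mono_left nhdsWithin_le_nhds)
      · exact tendsto_iff_norm_sub_tendsto_zero.1 (S.continuousOn_Icc _ _ t ht)
    rw [mul_zero, add_zero] at hl
    refine squeeze_zero' (Eventually.of_forall fun _ => norm_nonneg _) ?_ hl
    filter_upwards [self_mem_nhdsWithin] with s hs
    rw [← sub_add_sub_cancel (S.T s (B (g (-(s : Circ))))) (S.T s (B (g (-(t : Circ))))), ← map_sub]
    exact (norm_add_le _ _).trans (by gcongr; exact (S.T s).le_of_opNorm_le (hM s hs) _)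
  have hlim : Tendsto (fun N => ∫ t in (0 : ℝ)..2 * π, S.T t (B (trigPoly (z N) (-t)))) atTop
      (𝓝 (c₀ • S.T (2 * π) (B x))) := by
    have hI : ∫ t in (0 : ℝ)..2 * π, S.T t (B (H (-t))) = c₀ • S.T (2 * π) (B x) := by
      rw [hc₀, ← intervalIntegral.integral_smul_const]
      refine intervalIntegral.integral_congr fun t ht => ?_
      rw [uIcc_of_le hπ.le] at ht
      exact hval t ht
    rw [← hI]
    refine Metric.tendsto_atTop.2 fun ε hε => ?_
    set L := M * ‖B‖ * (2 * π) with hL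
    have hL0 : 0 ≤ L := by positivity
    obtain ⟨N₀, hN₀⟩ := happ (ε / (L + 1)) (by positivity)
    refine ⟨N₀, fun N hN => ?_⟩
    rw [dist_eq_norm, ← intervalIntegral.integral_sub (hint _ (continuous_trigPoly _))
      (hint _ hHc)]
    simp only [← map_sub]
    refine (intervalIntegral.norm_integral_le_of_norm_le_const
      (C := M * ‖B‖ * (ε / (L + 1))) fun t ht => ?_).trans_lt ?_
    · rw [uIoc_of_le hπ.le] at ht
      exact norm_T_map_le hM ⟨ht.1.le, ht.2⟩ (hN₀ N hN _)
    · rw [sub_zero, abs_of_pos hπ]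
      calc _ = ε * (L / (L + 1)) := by rw [hL]; ring
        _ < ε * 1 := by
          gcongr
          rw [div_lt_one (by positivity)]
          linarith
        _ = ε := mul_one _
  have hlim' : Tendsto (fun N => operatorPoly R B 0 (z N) -
      S.T (2 * π) (operatorPoly R B 0 (z N))) atTop (𝓝 (u - S.T (2 * π) u)) :=
    hu.sub (((S.T (2 * π)).continuous.tendsto u).comp hu)
  simp only [hid] at hlim'
  have hfin := tendsto_nhds_unique hlim' hlim
  -- Since `D u = c₀ T_{2π} B x`, the second term supplies the `T_{2π} B x` that is missing from `D
  -- (B x)`.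
  refine ⟨B x + c₀⁻¹ • u, ?_⟩
  simp only
  rw [map_add, (S.T (2 * π)).map_smul_of_tower, add_sub_add_comm, ← smul_sub, hfin,
    inv_smul_smul₀ hc₀pos.ne', sub_add_cancel]

end C0Semigroup

/-! ### Smooth test functions and the lattice `L_1` -/

section SmoothFunctions

theorem integral_exp_mul_deriv {f : ℝ → ℂ} (hf : ContDiff ℝ 1 f) (h0 : f 0 = f (2 * π)) (n : ℤ) :
    ∫ t in (0 : ℝ)..2 * π, (fourier (-n) (t : Circ) : ℂ) * deriv f t =
      (n : ℂ) * Complex.I * ∫ t in (0 : ℝ)..2 * π, (fourier (-n) (t : Circ) : ℂ) * f t := by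
  have hfc : Continuous f := hf.continuous
  have hfd : Continuous (deriv f) := hf.continuous_deriv le_rfl
  have hE := C0Semigroup.continuous_fourier_coe (-n)
  have hd : ∀ t : ℝ, HasDerivAt (fun t : ℝ => (fourier (-n) (t : Circ) : ℂ) * f t)
      ((fourier (-n) (t : Circ) : ℂ) * deriv f t -
        (n : ℂ) * Complex.I * ((fourier (-n) (t : Circ) : ℂ) * f t)) t := by
    intro t
    have h1 : HasDerivAt (fun t : ℝ => (fourier (-n) (t : Circ) : ℂ))
        ((fourier (-n) (t : Circ) : ℂ) * ((((-n : ℤ) : ℂ) * Complex.I) * 1)) t := by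
      simp only [fourier_coe_circ]
      exact ((Complex.ofRealCLM.hasDerivAt (x := t)).const_mul (((-n : ℤ) : ℂ) * Complex.I)).cexp
    convert! h1.mul (hf.differentiable (by simp) t).hasDerivAt using 1
    push_cast
    ring
  have h := intervalIntegral.integral_eq_sub_of_hasDerivAt (a := 0) (b := 2 * π) (fun t _ => hd t)
    (Continuous.intervalIntegrable (by fun_prop) _ _)
  rw [AddCircle.coe_period, AddCircle.coe_zero, h0, sub_self, intervalIntegral.integral_sub
    (Continuous.intervalIntegrable (by fun_prop) _ _)
    (Continuous.intervalIntegrable (by fun_prop) _ _), intervalIntegral.integral_const_mul] at h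
  exact sub_eq_zero.1 h

/-- Two integrations by parts give decay of order `1/n²`. -/
theorem summable_fourierCoeff_of_contDiff {φ : Circ → ℂ}
    (hφ : ContDiff ℝ 2 fun t : ℝ => φ (t : Circ)) : Summable (fourierCoeff φ) := by
  set f : ℝ → ℂ := fun t => φ (t : Circ) with hf
  have hper : ∀ t, f (t + 2 * π) = f t := fun t => by
    simp only [hf]
    rw [AddCircle.coe_add_period]
  have h0 : f 0 = f (2 * π) := by rw [← hper 0, zero_add]
  have hf' : ContDiff ℝ 1 (deriv f) := by
    have : ContDiff ℝ (1 + 1) f := by norm_num; exact hφ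
    exact (contDiff_succ_iff_deriv.1 this).2.2
  have h0' : deriv f 0 = deriv f (2 * π) := by
    rw [← zero_add (2 * π), ← deriv_comp_add_const]
    simp only [hper]
  obtain ⟨C, hC⟩ := (isCompact_Icc (a := 0) (b := 2 * π)).exists_bound_of_continuousOn
    (hf'.continuous_deriv le_rfl).continuousOn
  refine Summable.of_norm_bounded_eventually
    ((Real.summable_one_div_int_pow.2 one_lt_two).mul_left C) ?_
  rw [Filter.eventually_cofinite]
  -- The index `0` is excluded because the majorant `C * (1 / 0 ^ 2)` is `0` there.
  refine (finite_singleton (0 : ℤ)).subset fun n hn => ?_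
  by_contra hn0
  rw [mem_singleton_iff] at hn0
  refine hn ?_
  have hn' : (0 : ℝ) < (n : ℝ) ^ 2 := by positivity
  have h1 := integral_exp_mul_deriv hf' h0' n
  rw [integral_exp_mul_deriv (hφ.of_le (by norm_num)) h0 n] at h1
  have h2 : ‖∫ t in (0 : ℝ)..2 * π, (fourier (-n) (t : Circ) : ℂ) * deriv (deriv f) t‖ ≤
      C * (2 * π) := by
    refine (intervalIntegral.norm_integral_le_of_norm_le_const (C := C) fun t ht => ?_).trans_eq ?_
    · rw [uIoc_of_le Real.two_pi_pos.le] at ht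
      rw [norm_mul, norm_fourier_apply, one_mul]
      exact hC t ⟨ht.1.le, ht.2⟩
    · rw [sub_zero, abs_of_pos Real.two_pi_pos]
  have h3 : (2 * π) * ‖fourierCoeff φ n‖ =
      ‖∫ t in (0 : ℝ)..2 * π, (fourier (-n) (t : Circ) : ℂ) * f t‖ := by
    have := integral_circMeasure fun t => (fourier (-n) t : ℂ) • φ t
    simp only [smul_eq_mul] at this
    rw [← this, norm_smul, Real.norm_of_nonneg Real.two_pi_pos.le, fourierCoeff]
    simp only [smul_eq_mul]
  simp only [h1, norm_mul, Complex.norm_I, mul_one, Complex.norm_intCast] at h2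
  rw [← h3] at h2
  have h4 : ‖fourierCoeff φ n‖ * (n : ℝ) ^ 2 ≤ C := by
    rw [← sq_abs]
    nlinarith [Real.two_pi_pos]
  rw [mul_one_div, le_div_iff₀ hn']
  exact h4

theorem continuous_of_continuous_comp_coe {E : Type*} [TopologicalSpace E] {φ : Circ → E}
    (hφ : Continuous fun t : ℝ => φ (t : Circ)) : Continuous φ :=
  (QuotientAddGroup.isQuotientMap_mk (N := AddSubgroup.zmultiples (2 * π))).continuous_iff.2 hφ

theorem contDiff_fejerKernel (N : ℕ) {n : WithTop ℕ∞} :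
    ContDiff ℝ n fun t : ℝ => (fejerKernel N (t : Circ) : ℂ) := by
  simp only [fejerKernel_eq, fejerMean, fourier_coe_circ]
  refine ContDiff.const_smul _ (ContDiff.sum fun j _ => ContDiff.sum fun l _ => ?_)
  exact (contDiff_const.mul Complex.ofRealCLM.contDiff).cexp

theorem hasSum_mul_fourierCoeff_fejerKernel (a : ℤ → ℂ) (N : ℕ) :
    HasSum (fun k => a k * fourierCoeff (fun t => (fejerKernel N t : ℂ)) k) (fejerMean a N) := by
  have h1 : ∀ k, fourierCoeff (fun t => (fejerKernel N t : ℂ)) k =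
      fejerMean (fun j => if j = k then 1 else 0) N := by
    intro k
    have := integral_fejerMean_smul (H := fun t => (fourier (-k) t : ℂ)) (by fun_prop) N
    simp only [smul_eq_mul, ← fourier_add, integral_fourier, add_neg_eq_zero] at this
    rw [← this, fourierCoeff]
    congr 1 with t
    rw [smul_eq_mul, mul_comm]
  have h2 : ∀ k, a k * fourierCoeff (fun t => (fejerKernel N t : ℂ)) k =
      (N : ℂ)⁻¹ • ∑ j ∈ Finset.range N, ∑ l ∈ Finset.range N,
        if k = (j : ℤ) - l then a ((j : ℤ) - l) else 0 := by
    intro k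
    rw [h1, fejerMean, smul_eq_mul, smul_eq_mul, mul_left_comm, Finset.mul_sum]
    congr 1
    refine Finset.sum_congr rfl fun j _ => ?_
    rw [Finset.mul_sum]
    refine Finset.sum_congr rfl fun l _ => ?_
    by_cases h : (j : ℤ) - l = k
    · rw [if_pos h, if_pos h.symm, h, mul_one]
    · rw [if_neg h, if_neg (Ne.symm h), mul_zero]
  simp only [h2]
  exact (hasSum_sum fun j _ => hasSum_sum fun l _ => hasSum_ite_eq _ _).const_smul _

end SmoothFunctions

/-- The lattice `L_1(𝕋)`. -/
def L1Lattice : QuasiNormedLattice where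
  carrier :=
    { carrier := {f | Integrable f circMeasure}
      add_mem' := fun {f g} hf hg => (Integrable.add hf hg).congr (AEEqFun.coeFn_add f g).symm
      zero_mem' := (integrable_zero Circ ℝ circMeasure).congr AEEqFun.coeFn_zero.symm
      smul_mem' := fun c f hf => (Integrable.smul c hf).congr (AEEqFun.coeFn_smul c f).symm }
  qnorm f := ∫ θ, |f θ| ∂circMeasure
  qnorm_nonneg _ _ := integral_nonneg fun _ => abs_nonneg _
  qnorm_eq_zero f hf := by
    rw [integral_eq_zero_iff_of_nonneg (fun _ => abs_nonneg _) (Integrable.abs hf)]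
    constructor
    · intro h
      refine AEEqFun.ext ?_
      filter_upwards [h, AEEqFun.coeFn_zero (α := Circ) (β := ℝ) (μ := circMeasure)] with θ hθ h0
      rw [h0]
      simpa using hθ
    · rintro rfl
      filter_upwards [AEEqFun.coeFn_zero (α := Circ) (β := ℝ) (μ := circMeasure)] with θ h0
      rw [h0]
      simp
  qnorm_smul c f _ := by
    rw [← integral_const_mul]
    refine integral_congr_ae ?_
    filter_upwards [AEEqFun.coeFn_smul c f] with θ hθ
    rw [hθ]
    simp [abs_mul]
  qnorm_add := by
    refine ⟨1, fun f hf g hg => ?_⟩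
    rw [one_mul, ← integral_add (Integrable.abs hf) (Integrable.abs hg)]
    refine integral_mono_ae ?_ ((Integrable.abs hf).add (Integrable.abs hg)) ?_
    · exact ((Integrable.add hf hg).congr (AEEqFun.coeFn_add f g).symm).abs
    · filter_upwards [AEEqFun.coeFn_add f g] with θ hθ
      rw [hθ]
      exact abs_add_le _ _
  solid f g hg hfg := by
    have hf : Integrable f circMeasure := Integrable.mono hg f.aestronglyMeasurable hfg
    exact ⟨hf, integral_mono_ae hf.abs (Integrable.abs hg) hfg⟩

/-! ### The operator `(I - T_{2π})⁻¹ B` and the dual inequality -/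

namespace C0Semigroup

variable {X : Type*} [NormedAddCommGroup X] [NormedSpace ℂ X] {S : C0Semigroup X}
  {R : ℤ → X →L[ℂ] X} {B : X →L[ℂ] X} {ω α : ℝ}

/-- Injectivity of `I - T_{2π}` makes the choice of preimages linear and its graph closed. -/
theorem exists_rightInverse_clm [CompleteSpace X]
    (hR : ∀ k : ℤ, IsResolventAt S.generator ((k : ℂ) * Complex.I) (R k))
    (h : range B ⊆ range fun y : X => y - S.T (2 * π) y) :
    ∃ G : X →L[ℂ] X, ∀ x, G x - S.T (2 * π) (G x) = B x := by
  have h' : ∀ x, ∃ y : X, y - S.T (2 * π) y = B x := fun x => h (mem_range_self x)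
  choose g hg using h'
  have hinj : ∀ y y' : X, y - S.T (2 * π) y = y' - S.T (2 * π) y' → y = y' := fun y y' he => by
    refine sub_eq_zero.1 (injective_sub_T hR ?_)
    rw [map_sub, sub_sub_sub_comm, he, sub_self]
  let L : X →ₗ[ℂ] X :=
    { toFun := g
      map_add' := fun x y => hinj _ _ (by rw [hg, map_add, map_add, add_sub_add_comm, hg, hg])
      map_smul' := fun c x => hinj _ _ (by
        rw [hg, RingHom.id_apply, map_smul, map_smul, ← smul_sub, hg]) }
  refine ⟨ContinuousLinearMap.ofSeqClosedGraph (g := L) fun u x y hu hy => hinj _ _ ?_, hg⟩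
  have h1 : Tendsto (fun n => L (u n) - S.T (2 * π) (L (u n))) atTop
      (𝓝 (y - S.T (2 * π) y)) := hy.sub (((S.T (2 * π)).continuous.tendsto y).comp hy)
  have h2 : Tendsto (fun n => L (u n) - S.T (2 * π) (L (u n))) atTop (𝓝 (B x)) := by
    have : (fun n => L (u n) - S.T (2 * π) (L (u n))) = fun n => B (u n) :=
      funext fun n => hg (u n)
    rw [this]
    exact (B.continuous.tendsto x).comp hu
  exact (tendsto_nhds_unique h1 h2).trans (hg x).symm

/-- The pairing `∑_k ⟨x', R_k (I - T_{2π}) y⟩ φ̂(k)` is the integral of `φ` against an orbit. -/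
theorem hasSum_dual_resolvent_mul_fourierCoeff [CompleteSpace X]
    (hR : ∀ k : ℤ, IsResolventAt S.generator ((k : ℂ) * Complex.I) (R k)) {M : ℝ}
    (hM : ∀ t ∈ Icc 0 (2 * π), ‖S.T t‖ ≤ M) (y : X) (x' : StrongDual ℂ X) {φ : C(Circ, ℂ)}
    (hφ : Summable (fourierCoeff φ)) :
    ∃ v : ℂ, HasSum (fun k => x' (R k (y - S.T (2 * π) y)) * fourierCoeff φ k) v ∧
      ‖v‖ ≤ ‖x'‖ * (M * ‖y‖) * (2 * π) * ∫ θ, ‖φ θ‖ ∂circMeasure := by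
  have hπ := Real.two_pi_pos
  have hψ : ContinuousOn (fun t => x' (S.T t y)) (Icc 0 (2 * π)) :=
    x'.continuous.comp_continuousOn (S.continuousOn_Icc y _)
  have hψM : ∀ t ∈ Icc 0 (2 * π), ‖x' (S.T t y)‖ ≤ ‖x'‖ * (M * ‖y‖) := fun t ht =>
    x'.le_opNorm_of_le ((S.T t).le_of_opNorm_le (hM t ht) y)
  have hcoe : Continuous fun t : ℝ => (t : Circ) := AddCircle.continuous_mk' _
  have hint : ∀ g : C(Circ, ℂ), IntervalIntegrable (fun t : ℝ => x' (S.T t y) * g (-t)) volume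
      0 (2 * π) := fun g => by
    have hg : Continuous fun t : ℝ => g (-(t : Circ)) := by fun_prop
    exact intervalIntegrable_of_continuousOn (hψ.mul hg.continuousOn)
  -- The reflection `g (-t)` makes the value at `fourier k` equal to `x'` of the orbit coefficient
  -- with the same index `k`.
  let Λ₀ : C(Circ, ℂ) →ₗ[ℂ] ℂ :=
    { toFun := fun g => ∫ t in (0 : ℝ)..2 * π, x' (S.T t y) * g (-t)
      map_add' := fun g g' => by
        rw [← intervalIntegral.integral_add (hint g) (hint g')]
        simp only [ContinuousMap.add_apply, mul_add]
      map_smul' := fun c g => by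
        rw [RingHom.id_apply, ← intervalIntegral.integral_smul]
        simp only [ContinuousMap.smul_apply, mul_smul_comm] }
  have hbound : ∀ g : C(Circ, ℂ),
      ‖Λ₀ g‖ ≤ ‖x'‖ * (M * ‖y‖) * (2 * π) * ∫ θ, ‖g θ‖ ∂circMeasure := by
    intro g
    have h2 := integral_circMeasure fun t => ‖g (-t)‖
    rw [integral_neg_eq_self (fun t => ‖g t‖) circMeasure, smul_eq_mul] at h2
    rw [mul_assoc, h2, ← intervalIntegral.integral_const_mul]
    refine intervalIntegral.norm_integral_le_of_norm_le hπ.le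
      (Eventually.of_forall fun t ht => ?_) (Continuous.intervalIntegrable (by fun_prop) _ _)
    rw [norm_mul]
    gcongr
    exact hψM t ⟨ht.1.le, ht.2⟩
  have hM0 : 0 ≤ M := (norm_nonneg _).trans (hM 0 ⟨le_rfl, hπ.le⟩)
  let Λ : C(Circ, ℂ) →L[ℂ] ℂ := Λ₀.mkContinuous (‖x'‖ * (M * ‖y‖) * (2 * π)) fun g =>
    (hbound g).trans (by
      gcongr
      have h3 : ∫ θ, ‖g θ‖ ∂circMeasure ≤ ∫ _ : Circ, ‖g‖ ∂circMeasure :=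
        integral_mono (integrable_of_continuous (by fun_prop)) (integrable_const _)
          fun θ => g.norm_coe_le_norm θ
      simpa using h3)
  refine ⟨Λ φ, ?_, hbound φ⟩
  -- The Fourier series of `φ` converges uniformly, so a functional continuous for the uniform norm
  -- may be applied term by term.
  have hs := Λ.hasSum (hasSum_fourier_series_of_summable hφ)
  convert! hs using 2 with k
  have hc : ContinuousOn (fun t : ℝ => (fourier (-k) (t : Circ) : ℂ) • S.T t y) (Icc 0 (2 * π)) :=
    (continuous_fourier_coe (-k)).continuousOn.smul (S.continuousOn_Icc y (2 * π))
  have h4 : Λ (fourier k) = x' (S.orbitCoeff y k) := by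
    rw [orbitCoeff, ← x'.intervalIntegral_comp_comm (intervalIntegrable_of_continuousOn hc)]
    refine intervalIntegral.integral_congr fun t _ => ?_
    rw [map_smul, smul_eq_mul, mul_comm, ← zero_sub, fourier_sub_apply, fourier_eval_zero, one_mul]
  rw [map_smul, h4, orbitCoeff_eq_map_sub (hR k), smul_eq_mul, mul_comm]

/-- The inequality for the matrix elements of the resolvents puts the range of `B` into the range
of `I - T_{2π}`. -/
theorem range_subset_of_dual_bound [CompleteSpace X]
    (hR : ∀ k : ℤ, IsResolventAt S.generator ((k : ℂ) * Complex.I) (R k))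
    (hBT : ∀ t, 0 ≤ t → ∀ x, B (S.T t x) = S.T t (B x)) {K : ℝ}
    (hK : ∀ (x : X) (x' : StrongDual ℂ X) (N : ℕ), N ≠ 0 →
      ‖fejerMean (fun k => x' (R k (B x))) N‖ ≤ K * ‖x‖ * ‖x'‖) (x : X) :
    B x ∈ range fun y : X => y - S.T (2 * π) y := by
  have hπ := Real.two_pi_pos
  let D : X →L[ℂ] X := ContinuousLinearMap.id ℂ X - S.T (2 * π)
  have hD : ∀ w, D w = w - S.T (2 * π) w := fun w => rfl
  have hBD : ∀ w, B (D w) = D (B w) := fun w => by rw [hD, hD, map_sub, hBT _ hπ.le]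
  -- The sign of `K` is not assumed; it follows from the inequality tested on a nonzero functional.
  have hK0 : ∀ w : X, 0 ≤ K * ‖w‖ := by
    intro w
    rcases subsingleton_or_nontrivial X with hX | hX
    · rw [Subsingleton.elim w 0, norm_zero, mul_zero]
    obtain ⟨v, hv⟩ := exists_ne (0 : X)
    obtain ⟨q, hq⟩ := SeparatingDual.exists_ne_zero (R := ℂ) hv
    have hq0 : 0 < ‖q‖ := norm_pos_iff.2 fun h => hq (by simp [h])
    have h1 := (norm_nonneg _).trans (hK w q 1 one_ne_zero)
    exact nonneg_of_mul_nonneg_left h1 hq0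
  -- The Cesàro limit bounds `B w + T_{2π} B w` by `‖D w‖`, and adding `B (D w) = B w - T_{2π} B w`
  -- leaves `2 B w`.
  have hbd : ∀ w, ‖B w‖ ≤ (K * π⁻¹ + ‖B‖) / 2 * ‖D w‖ := by
    intro w
    have hlim := tendsto_fejerMean_resolvent hR (B w)
    simp only [← hD, ← hBD] at hlim
    have h1 : ‖(π : ℂ) • (B w + S.T (2 * π) (B w))‖ ≤ K * ‖D w‖ := by
      refine le_of_tendsto hlim.norm ?_
      filter_upwards [eventually_ne_atTop 0] with N hN
      refine NormedSpace.norm_le_dual_bound ℂ _ (hK0 _) fun q => ?_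
      have := hK (D w) q N hN
      rwa [show fejerMean (fun k => q (R k (B (D w)))) N =
        q (fejerMean (fun k => R k (B (D w))) N) from
          fejerMean_map (q : X →ₗ[ℂ] ℂ) (fun k => R k (B (D w))) N] at this
    rw [norm_smul, Complex.norm_real, Real.norm_of_nonneg Real.pi_pos.le] at h1
    have h2 : ‖B w + S.T (2 * π) (B w)‖ ≤ K * π⁻¹ * ‖D w‖ := by
      rw [mul_right_comm, ← div_eq_mul_inv, le_div_iff₀ Real.pi_pos, mul_comm]
      exact h1
    have h3 : B w + B w = (B w + S.T (2 * π) (B w)) + B (D w) := by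
      rw [hBD, hD]
      abel
    have h4 : ‖B w + B w‖ = 2 * ‖B w‖ := by
      rw [← two_smul ℝ, norm_smul, Real.norm_of_nonneg zero_le_two]
    have h5 := norm_add_le (B w + S.T (2 * π) (B w)) (B (D w))
    rw [← h3, h4] at h5
    have h6 := B.le_opNorm (D w)
    linarith
  -- With `D w_n → x`, the bound makes `B w_n` Cauchy, and `D` maps its limit to `B x`.
  obtain ⟨d, hd, hdx⟩ := mem_closure_iff_seq_limit.1 (dense_range_sub_T hR x)
  choose w hw using hd
  have hw' : ∀ n, D (w n) = d n := hw
  have hcauchy : CauchySeq fun n => B (w n) := by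
    set C := (K * π⁻¹ + ‖B‖) / 2 with hC
    have hdc := Metric.cauchySeq_iff'.1 hdx.cauchySeq
    refine Metric.cauchySeq_iff'.2 fun ε hε => ?_
    obtain ⟨N, hN⟩ := hdc (ε / (|C| + 1)) (by positivity)
    refine ⟨N, fun n hn => ?_⟩
    have h1 := hN n hn
    rw [dist_eq_norm] at h1 ⊢
    have h2 := hbd (w n - w N)
    rw [map_sub, map_sub, hw', hw'] at h2
    calc _ ≤ C * ‖d n - d N‖ := h2
      _ ≤ (|C| + 1) * ‖d n - d N‖ := by
          gcongr
          linarith [le_abs_self C]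
      _ < (|C| + 1) * (ε / (|C| + 1)) := by gcongr
      _ = ε := by field_simp
  obtain ⟨y, hy⟩ := cauchySeq_tendsto_of_complete hcauchy
  have h1 : Tendsto (fun n => D (B (w n))) atTop (𝓝 (D y)) := (D.continuous.tendsto y).comp hy
  have h2 : Tendsto (fun n => D (B (w n))) atTop (𝓝 (B x)) := by
    simp only [← hBD, hw']
    exact (B.continuous.tendsto x).comp hdx
  exact ⟨y, tendsto_nhds_unique h1 h2⟩

end C0Semigroup

/-! ### Multiplier bounds and pointwise bounds -/

namespace C0Semigroup

variable {X : Type*} [NormedAddCommGroup X] [NormedSpace ℂ X] {S : C0Semigroup X}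
  {R : ℤ → X →L[ℂ] X} {B : X →L[ℂ] X} {ω α : ℝ}

/-- At a minimum point of the norm, the constant function with that value lies below `‖L f(·)‖`;
monotonicity of a norm or quasi-norm then bounds the value there. -/
theorem exists_forall_norm_operatorPoly_ge (z : ℤ →₀ X) :
    ∃ s, ∀ θ, ‖operatorPoly R B s z‖ ≤ ‖operatorPoly R B θ z‖ := by
  obtain ⟨s, -, hs⟩ := isCompact_univ.exists_isMinOn univ_nonempty
    (continuous_operatorPoly R B z).norm.continuousOn
  exact ⟨s, fun θ => hs (mem_univ θ)⟩

theorem exists_norm_operatorPoly_le_of_isLpMultiplier (hB : Function.Injective B)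
    (hBf : ∀ v : S.Xα ω α, B (S.fracPow ω α v) = v) (hr : (S.Xα ω α : Set X) = range B)
    {p : ℝ≥0∞} (hp : 1 ≤ p) (h : IsLpMultiplier S ω α p R) :
    ∃ C : ℝ, ∀ (z : ℤ →₀ X) (D : ℝ), (∀ θ, ‖trigPoly z θ‖ ≤ D) →
      ∃ s, ‖operatorPoly R B s z‖ ≤ C * D := by
  obtain ⟨C, hC⟩ := h
  refine ⟨C, fun z D hD => ?_⟩
  have hD0 : 0 ≤ D := (norm_nonneg _).trans (hD 0)
  obtain ⟨s, hs⟩ := exists_forall_norm_operatorPoly_ge (R := R) (B := B) z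
  obtain ⟨c, rfl⟩ := exists_mapRange_fracPow hB hBf hr z
  refine ⟨s, ?_⟩
  have h1 := (hC c).trans (mul_le_mul_right (LpαNorm_le_of_forall_norm_le (p := p) hD) _)
  rw [show multiplierOp R c = _ from funext fun θ => multiplierOp_eq_operatorPoly hBf c θ] at h1
  have h2 := (eLpNorm_mono (p := p) (μ := circMeasure)
    (f := fun _ : Circ => operatorPoly R B s _) hs).trans h1
  rw [eLpNorm_const _ (zero_lt_one.trans_le hp).ne' (NeZero.ne _), measure_univ,
    ENNReal.one_rpow, mul_one, ← ofReal_norm, ← ENNReal.ofReal_coe_nnreal,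
    ← ENNReal.ofReal_mul C.coe_nonneg] at h2
  exact (ENNReal.ofReal_le_ofReal_iff (by positivity)).1 h2

theorem exists_norm_operatorPoly_le_of_isLatticeMultiplier (hB : Function.Injective B)
    (hBf : ∀ v : S.Xα ω α, B (S.fracPow ω α v) = v) (hr : (S.Xα ω α : Set X) = range B)
    {F : QuasiNormedLattice} (h : IsLatticeMultiplier S ω α F R) :
    ∃ C : ℝ, ∀ (z : ℤ →₀ X) (D : ℝ), (∀ θ, ‖trigPoly z θ‖ ≤ D) →
      ∃ s, ‖operatorPoly R B s z‖ ≤ C * D := by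
  obtain ⟨C, hC⟩ := h
  set e : Circ →ₘ[circMeasure] ℝ := AEEqFun.const Circ 1 with he
  -- It is not known yet that the constant `1` lies in `F`, so its quasi-norm may have any sign; the
  -- absolute value keeps the constant nonnegative.
  refine ⟨C * |F.qnorm e|⁻¹, fun z D hD => ?_⟩
  have hD0 : 0 ≤ D := (norm_nonneg _).trans (hD 0)
  obtain ⟨s, hs⟩ := exists_forall_norm_operatorPoly_ge (R := R) (B := B) z
  obtain ⟨c, rfl⟩ := exists_mapRange_fracPow hB hBf hr z
  refine ⟨s, ?_⟩
  set m := ‖operatorPoly R B s (c.mapRange (S.fracPow ω α) (S.fracPow ω α).map_zero)‖ with hm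
  obtain ⟨hmem, hle⟩ := hC c
  have h1 := hle.trans (mul_le_mul_right (LpαNorm_le_of_forall_norm_le (p := 1) hD) _)
  rw [← ENNReal.ofReal_coe_nnreal, ← ENNReal.ofReal_mul C.coe_nonneg,
    ENNReal.ofReal_le_ofReal_iff (by positivity)] at h1
  have hm0 : 0 ≤ m := norm_nonneg _
  have hdom : ∀ᵐ θ ∂circMeasure, |(m • e) θ| ≤ |multiplierOpNorm R c θ| := by
    filter_upwards [AEEqFun.coeFn_smul m e, AEEqFun.coeFn_const Circ (μ := circMeasure) (1 : ℝ),
      AEEqFun.coeFn_mk (fun θ => ‖multiplierOp R c θ‖)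
        (continuous_multiplierOp R c).norm.aestronglyMeasurable] with θ h1 h2 h3
    rw [multiplierOpNorm, h1, h3, Pi.smul_apply, h2, multiplierOp_eq_operatorPoly hBf]
    simpa [abs_of_nonneg hm0] using hs θ
  obtain ⟨hme, hq⟩ := F.solid _ _ hmem hdom
  -- Only a positive minimum puts the constant `1` in `F`; a zero minimum needs no estimate.
  rcases hm0.eq_or_lt with h0 | hpos
  · rw [← h0]
    positivity
  have hee : e ∈ F.carrier := by
    have := F.carrier.smul_mem m⁻¹ hme
    rwa [inv_smul_smul₀ hpos.ne'] at this
  have he0 : e ≠ 0 := by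
    intro h
    have h2 := AEEqFun.coeFn_const Circ (μ := circMeasure) (1 : ℝ)
    rw [← he, h] at h2
    have h3 : ∀ᵐ θ : Circ ∂circMeasure, False := by
      filter_upwards [h2, AEEqFun.coeFn_zero (α := Circ) (β := ℝ) (μ := circMeasure)] with θ h4 h5
      rw [h5] at h4
      simp at h4
    obtain ⟨_, hθ⟩ := h3.exists
    exact hθ
  have hqe : 0 < F.qnorm e :=
    lt_of_le_of_ne (F.qnorm_nonneg e hee) fun h => he0 ((F.qnorm_eq_zero e hee).1 h.symm)
  rw [F.qnorm_smul m e hee, abs_of_pos hpos] at hq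
  rw [abs_of_pos hqe, mul_right_comm, ← div_eq_mul_inv, le_div_iff₀ hqe]
  exact hq.trans h1

/-- On a probability space the `L_p` norm is at most the supremum and at least the `L_1` norm. -/
theorem isLpMultiplier_of_forall_norm_le (hBf : ∀ v : S.Xα ω α, B (S.fracPow ω α v) = v) {C : ℝ}
    (hC : ∀ (z : ℤ →₀ X) (θ : Circ),
      ‖operatorPoly R B θ z‖ ≤ C * ∫ θ, ‖trigPoly z θ‖ ∂circMeasure)
    {p : ℝ≥0∞} (hp : 1 ≤ p) : IsLpMultiplier S ω α p R := by
  refine ⟨C.toNNReal, fun c => ?_⟩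
  set z := c.mapRange (S.fracPow ω α) (S.fracPow ω α).map_zero with hz
  have hc := continuous_trigPoly z
  have h1 : eLpNorm (multiplierOp R c) p circMeasure ≤
      ENNReal.ofReal (C * ∫ θ, ‖trigPoly z θ‖ ∂circMeasure) := by
    refine (eLpNorm_le_of_ae_bound (C := C * ∫ θ, ‖trigPoly z θ‖ ∂circMeasure)
      (Eventually.of_forall fun θ => ?_)).trans_eq (by simp)
    rw [multiplierOp_eq_operatorPoly hBf]
    exact hC z θ
  have h2 : ENNReal.ofReal (∫ θ, ‖trigPoly z θ‖ ∂circMeasure) ≤ LpαNorm S ω α p c := by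
    rw [LpαNorm_eq, ← hz, ofReal_integral_norm_eq_lintegral_enorm (integrable_of_continuous hc),
      ← eLpNorm_one_eq_lintegral_enorm]
    exact eLpNorm_le_eLpNorm_of_exponent_le hp hc.aestronglyMeasurable
  refine h1.trans ?_
  rw [ENNReal.ofReal_mul' (integral_nonneg fun _ => norm_nonneg _)]
  gcongr
  exact le_rfl

theorem isLatticeMultiplier_L1Lattice (h : IsLpMultiplier S ω α 1 R) :
    IsLatticeMultiplier S ω α L1Lattice R := by
  obtain ⟨C, hC⟩ := h
  refine ⟨C, fun c => ?_⟩
  have hc := continuous_multiplierOp R c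
  have hmk : multiplierOpNorm R c =ᵐ[circMeasure] fun θ => ‖multiplierOp R c θ‖ :=
    AEEqFun.coeFn_mk _ _
  refine ⟨(integrable_of_continuous hc.norm).congr hmk.symm, le_trans (le_of_eq ?_) (hC c)⟩
  change ENNReal.ofReal (∫ θ, |multiplierOpNorm R c θ| ∂circMeasure) = _
  rw [eLpNorm_one_eq_lintegral_enorm,
    ← ofReal_integral_norm_eq_lintegral_enorm (integrable_of_continuous hc)]
  congr 1
  refine integral_congr_ae ?_
  filter_upwards [hmk] with θ hθ
  rw [hθ, abs_norm]

end C0Semigroup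

end SemigroupMultiplier

end

/-! ### The equivalences -/

theorem theorem4p1 {X : Type*} [NormedAddCommGroup X] [NormedSpace ℂ X] [CompleteSpace X]
    (S : C0Semigroup X) (ω α : ℝ) (hα : 0 ≤ α) (hω : S.growthBound < (ω : EReal))
    (hρ : ∀ k : ℤ, (k : ℂ) * Complex.I ∈ resSet S.generator) :
    List.TFAE [
      -- the inclusion of `X_α` in the range of `I - T_{2π}`
      (S.Xα ω α : Set X) ⊆ Set.range (fun y : X => y - S.T (2 * π) y),
      -- Cesàro summability of the resolvents
      ∀ x ∈ S.Xα ω α,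
        CesaroSummable (fun k : ℤ => res S.generator ((k : ℂ) * Complex.I) x),
      -- `L_p` multiplier, for some `p`
      ∃ p : ℝ≥0∞, 1 ≤ p ∧ p ≠ ∞ ∧
        IsLpMultiplier S ω α p (fun k : ℤ => res S.generator ((k : ℂ) * Complex.I)),
      -- `L_p` multiplier, for all `p`
      ∀ p : ℝ≥0∞, 1 ≤ p → p ≠ ∞ →
        IsLpMultiplier S ω α p (fun k : ℤ => res S.generator ((k : ℂ) * Complex.I)),
      -- multiplier from `L_1` into some quasi-normed function lattice
      ∃ F : QuasiNormedLattice,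
        IsLatticeMultiplier S ω α F (fun k : ℤ => res S.generator ((k : ℂ) * Complex.I)),
      -- the inequality for the matrix elements of the resolvent
      ∃ K : ℝ, 0 < K ∧ ∀ (x : S.Xα ω α) (x' : StrongDual ℂ X) (φ : Circ → ℂ),
        ContDiff ℝ ((⊤ : ℕ∞) : WithTop ℕ∞) (fun t : ℝ => φ (t : Circ)) →
          Summable (fun k : ℤ =>
            x' (res S.generator ((k : ℂ) * Complex.I) x) * fourierCoeff φ k) ∧
          ‖∑' k : ℤ, x' (res S.generator ((k : ℂ) * Complex.I) x) * fourierCoeff φ k‖ ≤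
            K * S.normα ω α x * ‖x'‖ * ∫ θ, ‖φ θ‖ ∂circMeasure] := by
  have hR : ∀ k : ℤ, IsResolventAt S.generator ((k : ℂ) * Complex.I)
      (res S.generator ((k : ℂ) * Complex.I)) := fun k => isResolventAt_res (hρ k)
  obtain ⟨B, hB, hBT, hr, hBf⟩ := S.exists_negFracPow_clm hα hω
  obtain ⟨M, hM0, hM⟩ := S.exists_bound_Icc hω
  set R : ℤ → X →L[ℂ] X := fun k => res S.generator ((k : ℂ) * Complex.I) with hRdef
  have hrange : (∀ x, B x ∈ range fun y : X => y - S.T (2 * π) y) →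
      (S.Xα ω α : Set X) ⊆ range fun y : X => y - S.T (2 * π) y := by
    rintro h v hv
    rw [hr] at hv
    obtain ⟨x, rfl⟩ := hv
    exact h x
  tfae_have 1 ↔ 2 := forall₂_congr fun x _ => C0Semigroup.mem_range_iff_cesaroSummable hR x
  tfae_have 1 → 4 := by
    intro h p hp _
    rw [hr] at h
    obtain ⟨G, hG⟩ := C0Semigroup.exists_rightInverse_clm hR h
    exact C0Semigroup.isLpMultiplier_of_forall_norm_le hBf
      (C0Semigroup.norm_operatorPoly_le hR hM hG) hp
  tfae_have 4 → 3 := fun h => ⟨1, le_rfl, ENNReal.one_ne_top, h 1 le_rfl ENNReal.one_ne_top⟩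
  tfae_have 4 → 5 := fun h =>
    ⟨L1Lattice, C0Semigroup.isLatticeMultiplier_L1Lattice (h 1 le_rfl ENNReal.one_ne_top)⟩
  tfae_have 3 → 1 := by
    rintro ⟨p, hp, -, h⟩
    obtain ⟨C, hC⟩ :=
      C0Semigroup.exists_norm_operatorPoly_le_of_isLpMultiplier hB hBf hr hp h
    exact hrange (C0Semigroup.range_subset_of_bound hR hBT hM hC)
  tfae_have 5 → 1 := by
    rintro ⟨F, h⟩
    obtain ⟨C, hC⟩ :=
      C0Semigroup.exists_norm_operatorPoly_le_of_isLatticeMultiplier hB hBf hr h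
    exact hrange (C0Semigroup.range_subset_of_bound hR hBT hM hC)
  tfae_have 1 → 6 := by
    intro h
    rw [hr] at h
    obtain ⟨G, hG⟩ := C0Semigroup.exists_rightInverse_clm hR h
    -- The `+ 1` keeps the constant positive even when `G = 0`.
    refine ⟨M * (‖G‖ + 1) * (2 * π), by positivity, fun x x' φ hφ => ?_⟩
    have hφc : Continuous φ := continuous_of_continuous_comp_coe hφ.continuous
    have hφ2 : ContDiff ℝ 2 fun t : ℝ => φ (t : Circ) := hφ.of_le (WithTop.coe_le_coe.2 (le_top : (2 : ℕ∞) ≤ ⊤))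
    obtain ⟨v, hv, hle⟩ := C0Semigroup.hasSum_dual_resolvent_mul_fourierCoeff hR hM
      (G (S.fracPow ω α x)) x' (φ := ⟨φ, hφc⟩) (summable_fourierCoeff_of_contDiff hφ2)
    rw [hG, hBf] at hv
    refine ⟨hv.summable, ?_⟩
    rw [show ∑' k : ℤ, x' (R k x) * fourierCoeff φ k = v from hv.tsum_eq]
    refine hle.trans ?_
    change _ ≤ M * (‖G‖ + 1) * (2 * π) * ‖S.fracPow ω α x‖ * ‖x'‖ * ∫ θ, ‖φ θ‖ ∂circMeasure
    refine mul_le_mul_of_nonneg_right ?_ (integral_nonneg fun _ => norm_nonneg _)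
    calc _ ≤ ‖x'‖ * (M * ((‖G‖ + 1) * ‖S.fracPow ω α x‖)) * (2 * π) := by
          gcongr
          exact (G.le_opNorm _).trans (by gcongr; linarith)
      _ = _ := by ring
  tfae_have 6 → 1 := by
    rintro ⟨K, -, hK⟩
    refine hrange (C0Semigroup.range_subset_of_dual_bound hR hBT (K := K) fun x x' N hN => ?_)
    have hx : B x ∈ S.Xα ω α := by
      rw [← SetLike.mem_coe, hr]
      exact mem_range_self x
    -- The Fejér kernel is a smooth function of `L_1` norm one, and its pairing with a sequence is
    -- the `N`-th Fejér mean.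
    have h1 := (hK ⟨B x, hx⟩ x' (fun t => (fejerKernel N t : ℂ)) (contDiff_fejerKernel N)).2
    rw [(hasSum_mul_fourierCoeff_fejerKernel (fun k => x' (R k (B x))) N).tsum_eq,
      C0Semigroup.normα, C0Semigroup.fracPow_apply_of_eq hB hBf (x := x) rfl] at h1
    simpa only [Complex.norm_real, Real.norm_of_nonneg (fejerKernel_nonneg _ _),
      integral_fejerKernel hN, mul_one] using h1
  tfae_finish
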